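/- Let $G=G(\mathcal V,\mathcal E)$ be a finite strongly connected directed graph (loops and multiple edges allowed), with source and target maps $s,t$. Its graph inverse semigroup $\mathcal S(G)$ is generated by a zero, idempotents $\mathbf 1_V$ ($V\in\mathcal V$) and symbols $e^-,e^+$ ($e\in\mathcal E$), with relations $\mathbf 1_U\mathbf 1_W=0$ for $U\ne W$, $f^-f^+=\mathbf 1_{s(f)}$, $f^-g^+=0$ for $f\neq g$, $\mathbf 1_{s(f)}f^-=f^-\mathbf 1_{t(f)}=f^-$, $\mathbf 1_{t(f)}f^+=f^+\mathbf 1_{s(f)}=f^+$. The Markov-Dyck shift of $G$ is the set of bi-infinite sequences over $\{e^-,e^+:e\in\mathcal E\}$ all of whose finite subwords have nonzero product in $\mathcal S(G)$, with the left shift. Let $\mathcal F_G\subset\mathcal E$ be the set of edges that are the only incoming edge of their target vertex, and suppose that $G(\mathcal V,\mathcal F_G)$ is a directed rooted tree of uniform height two, i.e. all its leaves are at level two. Contracting this tree to its root yields a graph $\widehat G$ with one vertex $R$ and one loop $\widehat e$ for every $e\in\mathcal E\setminus\mathcal F_G$. For $e \in \mathcal E\setminus\mathcal F_G$ put $\widehat{e^{\mp}}=\widehat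 e^{\,\mp}$, and for $f\in\mathcal F_G$ put $\widehat{f^{\mp}}=\mathbf 1_R$. For $e\in\mathcal E\setminus\mathcal F_G$ and $k\in\mathbb N$ let $I^{(e)}_k$ be the number of periodic orbits of length $k$ of the Markov-Dyck shift with negative multiplier $\widehat e$, i.e. the orbits of points $p$ of least period $k$ such that, for some $i\in\mathbb Z$ and some $m\ge 1$, $\prod_{i\le j<i+k}\widehat{p_j}=(\widehat e^{\,-})^m$ in $\mathcal S(\widehat G)$. Theorem. If each of $I^{(e)}_5$, $I^{(e)}_9$ and $I^{(e)}_{10}$ takes the same value for all $e\in\mathcal E\setminus\mathcal F_G$, then $G$ is spherically homogeneous: all leaves of the tree $G(\mathcal V,\mathcal F_G)$ are at the same level, vertices at the same level have the same out-degree in the tree, the source of every edge in $\mathcal E\setminus\mathcal F_G$ is a leaf of the tree, and all leaves of the tree have the same out-degree in $G$. -/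

import Mathlib

/-- A directed graph with vertex set `V` and edge set `E`. Loops and multiple edges are allowed. -/
structure DirectedMultigraph (V E : Type*) where
  /-- the source vertex of an edge -/
  src : E → V
  /-- the target vertex of an edge -/
  tgt : E → V

namespace DirectedMultigraph

variable {V E : Type*}

/-! ### Graph inverse semigroups -/

/-- Symbols that generate the graph inverse semigroup: the zero, the idempotents `1_v`, and the
two copies `e⁻`, `e⁺` of every edge `e`. -/
inductive Gen (V E : Type*)
  | zero : Gen V E
  | idem (v : V) : Gen V E
  | neg (e : E) : Gen V E
  | pos (e : E) : Gen V E

open FreeMonoid in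
/-- The defining relations of the graph inverse semigroup. The first two say that `zero` is a zero
element. -/
inductive Rel (G : DirectedMultigraph V E) : FreeMonoid (Gen V E) → FreeMonoid (Gen V E) → Prop
  | zero_left (x : Gen V E) : Rel G (of .zero * of x) (of .zero)
  | zero_right (x : Gen V E) : Rel G (of x * of .zero) (of .zero)
  | idem_self (v : V) : Rel G (of (.idem v) * of (.idem v)) (of (.idem v))
  | idem_ne (u v : V) : u ≠ v → Rel G (of (.idem u) * of (.idem v)) (of .zero)
  | neg_pos_self (f : E) : Rel G (of (.neg f) * of (.pos f)) (of (.idem (G.src f)))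
  | neg_pos_ne (f g : E) : f ≠ g → Rel G (of (.neg f) * of (.pos g)) (of .zero)
  | src_neg (f : E) : Rel G (of (.idem (G.src f)) * of (.neg f)) (of (.neg f))
  | neg_tgt (f : E) : Rel G (of (.neg f) * of (.idem (G.tgt f))) (of (.neg f))
  | tgt_pos (f : E) : Rel G (of (.idem (G.tgt f)) * of (.pos f)) (of (.pos f))
  | pos_src (f : E) : Rel G (of (.pos f) * of (.idem (G.src f))) (of (.pos f))

/-- The graph inverse semigroup `S(G)`, with an identity element adjoined (the empty product).
Only products of nonempty words of generators are considered below, so that the adjoined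
identity plays no role. -/
abbrev InvSemigroup (G : DirectedMultigraph V E) := PresentedMonoid G.Rel

/-- The generator `x` as an element of `S(G)`. -/
def gen (G : DirectedMultigraph V E) (x : Gen V E) : G.InvSemigroup := PresentedMonoid.of G.Rel x

/-! ### The Markov-Dyck shift -/

/-- The alphabet `E⁻ ∪ E⁺` of the Markov-Dyck shift. -/
inductive Letter (E : Type*)
  | neg (e : E) : Letter E
  | pos (e : E) : Letter E

/-- A letter as a generator of the graph inverse semigroup. -/
def Letter.toGen : Letter E → Gen V E
  | .neg e => .neg e
  | .pos e => .pos e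

/-- The Markov-Dyck shift of `G`: the bi-infinite sequences all of whose finite (nonempty)
subwords have a nonzero product in `S(G)`. -/
def markovDyckShift (G : DirectedMultigraph V E) : Set (ℤ → Letter E) :=
  {x | ∀ (i : ℤ) (n : ℕ), 0 < n →
    ((List.range n).map fun j : ℕ => G.gen (x (i + j)).toGen).prod ≠ G.gen .zero}

/-- The left shift on bi-infinite sequences. -/
def shift {A : Type*} (x : ℤ → A) : ℤ → A := fun i => x (i + 1)

/-! ### The edge set `F_G` and the contracted graph -/

/-- The set `F_G` of the edges that are the only incoming edge of their target vertex. -/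
def treeEdges (G : DirectedMultigraph V E) : Set E :=
  {e | ∀ e', G.tgt e' = G.tgt e → e' = e}

/-- The connected components of the graph `(V, F_G)` (the subtrees of `G`). -/
def Subtree (G : DirectedMultigraph V E) : Type _ :=
  Quot fun u v : V => ∃ f ∈ G.treeEdges, G.src f = u ∧ G.tgt f = v

/-- The component of `(V, F_G)` to which a vertex belongs. -/
def subtreeOf (G : DirectedMultigraph V E) (v : V) : G.Subtree := Quot.mk _ v

/-- The graph `Ĝ` obtained from `G` by contracting every subtree to one vertex (its root).
Its edges `ê` correspond to the edges `e` of `G` outside `F_G`. -/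
def contraction (G : DirectedMultigraph V E) :
    DirectedMultigraph G.Subtree {e : E // e ∉ G.treeEdges} where
  src e := G.subtreeOf (G.src e)
  tgt e := G.subtreeOf (G.tgt e)

open Classical in
/-- The map that sends `e⁻`, `e⁺` to `ê⁻`, `ê⁺` if `e` is not in `F_G`, and to the idempotent of
the subtree that contains `e` if `e` is in `F_G`. -/
noncomputable def hat (G : DirectedMultigraph V E) :
    Letter E → Gen G.Subtree {e : E // e ∉ G.treeEdges}
  | .neg e => if h : e ∈ G.treeEdges then .idem (G.subtreeOf (G.src e)) else .neg ⟨e, h⟩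
  | .pos e => if h : e ∈ G.treeEdges then .idem (G.subtreeOf (G.src e)) else .pos ⟨e, h⟩

/-! ### Periodic orbits with a given multiplier -/

/-- The periodic point `x` has negative multiplier `ê`: the product in `S(Ĝ)` of the images of the
letters of `x` over one period, read off from a suitable position, is a positive power of `ê⁻`.
(Used when `ê` is a loop of `Ĝ`, that is, a cycle of length one, as is always the case if `G` has
only one subtree.) -/
def HasNegMultiplier (G : DirectedMultigraph V E) (e : {e : E // e ∉ G.treeEdges})
    (x : ℤ → Letter E) : Prop :=
  ∃ (i : ℤ) (m : ℕ), 0 < m ∧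
    ((List.range (Function.minimalPeriod shift x)).map
      fun j : ℕ => G.contraction.gen (G.hat (x (i + j)))).prod = G.contraction.gen (.neg e) ^ m

/-- The set of periodic orbits of length `k` of the Markov-Dyck shift of `G` with negative
multiplier `ê`. -/
def orbitsWithMultiplier (G : DirectedMultigraph V E) (e : {e : E // e ∉ G.treeEdges}) (k : ℕ) :
    Set (Cycle (ℤ → Letter E)) :=
  {o | ∃ x ∈ G.markovDyckShift, x ∈ Function.periodicPts shift ∧
    Function.minimalPeriod shift x = k ∧ G.HasNegMultiplier e x ∧
    o = Function.periodicOrbit shift x}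

/-- The number `I^(e)_k` of periodic orbits of length `k` with negative multiplier `ê`. -/
noncomputable def orbitCount (G : DirectedMultigraph V E) (e : {e : E // e ∉ G.treeEdges})
    (k : ℕ) : ℕ :=
  (G.orbitsWithMultiplier e k).ncard

/-! ### Paths, trees and spherical homogeneity -/

/-- `G.IsPath S u v p`: the list `p` of edges from `S` is a directed path from `u` to `v`. -/
def IsPath (G : DirectedMultigraph V E) (S : Set E) : V → V → List E → Prop
  | u, v, [] => u = v
  | u, v, e :: p => e ∈ S ∧ G.src e = u ∧ IsPath G S (G.tgt e) v p

/-- Any two vertices are joined by a directed path. -/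
def StronglyConnected (G : DirectedMultigraph V E) : Prop :=
  ∀ u v : V, ∃ p, G.IsPath Set.univ u v p

/-- The graph `(V, F_G)` is a (directed, rooted) tree with root `r`. -/
def IsTreeWithRoot (G : DirectedMultigraph V E) (r : V) : Prop :=
  ∀ v : V, ∃! p, G.IsPath G.treeEdges r v p

/-- The vertex `v` is at level `n` of the tree `(V, F_G)` with root `r`. -/
def AtLevel (G : DirectedMultigraph V E) (r v : V) (n : ℕ) : Prop :=
  ∃ p, G.IsPath G.treeEdges r v p ∧ p.length = n

/-- The vertex `v` is a leaf of `(V, F_G)`: no edge of `F_G` starts at `v`. -/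
def IsLeaf (G : DirectedMultigraph V E) (v : V) : Prop :=
  ∀ f ∈ G.treeEdges, G.src f ≠ v

/-- The number of edges of `G` that start at `v`. -/
noncomputable def outDegree (G : DirectedMultigraph V E) (v : V) : ℕ :=
  {e : E | G.src e = v}.ncard

/-- The number of edges of `F_G` that start at `v`. -/
noncomputable def treeOutDegree (G : DirectedMultigraph V E) (v : V) : ℕ :=
  {e : E | e ∈ G.treeEdges ∧ G.src e = v}.ncard

/-- `(V, F_G)` is a tree of uniform height `h`: all of its leaves are at level `h`. -/
def HasTreeOfUniformHeight (G : DirectedMultigraph V E) (h : ℕ) : Prop :=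
  ∃ r, G.IsTreeWithRoot r ∧ ∀ v, G.IsLeaf v → G.AtLevel r v h

/-- `G` is spherically homogeneous: `(V, F_G)` is a tree, its leaves are all at the same level,
vertices at the same level have the same out-degree in the tree, every edge outside `F_G` starts
at a leaf, and all leaves have the same out-degree in `G`. -/
def IsSphericallyHomogeneous (G : DirectedMultigraph V E) : Prop :=
  ∃ r, G.IsTreeWithRoot r ∧
    (∃ h, ∀ v, G.IsLeaf v → G.AtLevel r v h) ∧
    (∀ u v n, G.AtLevel r u n → G.AtLevel r v n → G.treeOutDegree u = G.treeOutDegree v) ∧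
    (∀ e ∉ G.treeEdges, G.IsLeaf (G.src e)) ∧
    (∀ u v, G.IsLeaf u → G.IsLeaf v → G.outDegree u = G.outDegree v)

end DirectedMultigraph

namespace DirectedMultigraph

variable {V E : Type*} {G : DirectedMultigraph V E} {r : V}

/-! ### Relations and the stack representation -/

/-! Every edge outside the tree ends at the root `r`. Let `T` be the tree path from `r` to the
source of such an edge `e`. A nonzero word reduces to pops followed by pushes. If the image of a
period is a power of `ê⁻`, then after a rotation to just behind an unmatched `e⁻` nothing is popped,
and the pushed path is `(T e)^m` for some `m > 0`. Thus each orbit comes from an ascent along `(T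
e)^m`, that is, this path with Dyck words inserted before its edges
(`IsTreeWithRoot.exists_isAscent`). Conversely, distinct ascents along `T e` give distinct orbits,
because only one `e` per period is unmatched. Hence orbit numbers are bounded above by a sum of
ascent counts over `m` and below by the term `m = 1`. The ascent counts are convolutions of Dyck
counts, and these satisfy the first-return recursion `dyckCount_succ`.

Let `a`, `p`, `q` be the out-degrees of the root, a level-one vertex and a leaf below it. An ascent
has length `m * (|T| + 1) + 2n`. For an edge at a leaf, length five forces `m = 1` and `n = 1`, so
the orbit number is `a + p + q`. An edge at level one has no orbits of odd length, so it cannot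
exist. Consequently `s = p + q` is the same along all branches. In length nine the count is, up to
one, a polynomial in `s`, `q` and the Dyck counts at the root, in which `q` has a coefficient of at
least two; so `q` is constant, and with it `p`.

A loop at the root remains to be excluded. Its length-five orbits number at least `r₂ + a`, where
`r₂` counts Dyck words of length four at the root, so `r₂ ≤ s`. For such large `s` the length-nine
number of an edge at a leaf, which grows like `s ^ 3`, exceeds the upper bound for the loop
(`loop_count_lt`). -/

lemma gen_mul_gen {x y z : Gen V E} (h : Rel G (.of x * .of y) (.of z)) :
    G.gen x * G.gen y = G.gen z :=
  (Con.eq _).2 (ConGen.Rel.of _ _ h)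

lemma gen_zero_mul (y : G.InvSemigroup) : G.gen .zero * y = G.gen .zero := by
  have key : ∀ l : FreeMonoid (Gen V E),
      G.gen .zero * PresentedMonoid.mk G.Rel l = G.gen .zero := by
    intro l
    induction l using FreeMonoid.inductionOn' with
    | one => exact mul_one _
    | of_mul x l ih =>
      rw [map_mul, ← mul_assoc]
      have : G.gen .zero * PresentedMonoid.mk G.Rel (.of x) = G.gen .zero :=
        gen_mul_gen (.zero_left x)
      rw [this, ih]
  exact PresentedMonoid.inductionOn y key

lemma mul_gen_zero (y : G.InvSemigroup) : y * G.gen .zero = G.gen .zero := by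
  have key : ∀ l : FreeMonoid (Gen V E),
      PresentedMonoid.mk G.Rel l * G.gen .zero = G.gen .zero := by
    intro l
    induction l using FreeMonoid.inductionOn' with
    | one => exact one_mul _
    | of_mul x l ih =>
      rw [map_mul, mul_assoc, ih]
      exact gen_mul_gen (.zero_right x)
  exact PresentedMonoid.inductionOn y key

open Classical in
/-- The action of a generator on the states of a stack machine: the current vertex and a stack of
edges. -/
noncomputable def stackStep (G : DirectedMultigraph V E) :
    Gen V E → V × List E → Option (V × List E)
  | .zero, _ => none
  | .idem v, s => if s.1 = v then some s else none
  | .neg e, s => if s.1 = G.src e then some (G.tgt e, e :: s.2) else none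
  | .pos _, (_, []) => none
  | .pos e, (v, f :: l) => if v = G.tgt e ∧ f = e then some (G.src e, l) else none

/-- The action of a generator on the states of a stack machine, extended to undefined states. -/
noncomputable def stackAct (G : DirectedMultigraph V E) (x : Gen V E) :
    Function.End (Option (V × List E)) :=
  fun s => s.bind (G.stackStep x)

lemma bind_stackStep_zero (s : Option (V × List E)) : s.bind (G.stackStep .zero) = none := by
  cases s <;> rfl

/-- The representation of the graph inverse semigroup on the states of a stack machine. -/
noncomputable def stackRep (G : DirectedMultigraph V E) :
    G.InvSemigroup →* (Function.End (Option (V × List E)))ᵐᵒᵖ :=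
  -- Words are read from left to right while endomorphisms compose from right to left, hence the
  -- opposite monoid.
  PresentedMonoid.lift (fun x => MulOpposite.op (G.stackAct x)) (by
    intro a b h
    cases h <;> simp only [map_mul, FreeMonoid.lift_eval_of, ← MulOpposite.op_mul] <;>
      congr 1 <;> funext s <;> change Option.bind (Option.bind s _) _ = Option.bind s _ <;>
      rcases s with _ | ⟨v, _ | ⟨f, l⟩⟩ <;>
      grind [stackStep, bind_stackStep_zero])

/-- The state reached from `s` under an element of the graph inverse semigroup. -/
noncomputable def run (G : DirectedMultigraph V E) (a : G.InvSemigroup)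
    (s : Option (V × List E)) : Option (V × List E) :=
  (G.stackRep a).unop s

lemma run_mul (a b : G.InvSemigroup) (s : Option (V × List E)) :
    G.run (a * b) s = G.run b (G.run a s) := by
  simp only [run, map_mul, MulOpposite.unop_mul]; rfl

lemma run_one (s : Option (V × List E)) : G.run 1 s = s := by
  simp only [run, map_one, MulOpposite.unop_one]; rfl

lemma run_gen (x : Gen V E) (s : Option (V × List E)) :
    G.run (G.gen x) s = s.bind (G.stackStep x) := rfl

lemma run_none (a : G.InvSemigroup) : G.run a none = none := by
  refine PresentedMonoid.inductionOn a fun l => ?_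
  induction l using FreeMonoid.inductionOn' with
  | one => rw [map_one, run_one]
  | of_mul x l ih => rw [map_mul, run_mul]; exact ih

lemma run_zero (s : Option (V × List E)) : G.run (G.gen .zero) s = none := by
  rw [run_gen]; cases s <;> rfl

/-- Zero sends every state to `none`, so a single state on which the machine survives certifies a
nonzero product. -/
lemma ne_zero_of_run {a : G.InvSemigroup} {s : Option (V × List E)} (h : G.run a s ≠ none) :
    a ≠ G.gen .zero := fun h0 => h (h0 ▸ run_zero s)

lemma run_idem (v : V) (l : List E) : G.run (G.gen (.idem v)) (some (v, l)) = some (v, l) := by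
  simp [run_gen, stackStep]

lemma run_neg (e : E) (l : List E) :
    G.run (G.gen (.neg e)) (some (G.src e, l)) = some (G.tgt e, e :: l) := by
  simp [run_gen, stackStep]

/-! ### Products of words -/

/-- The product in the graph inverse semigroup of a word over the alphabet of the shift. -/
def eval (G : DirectedMultigraph V E) (w : List (Letter E)) : G.InvSemigroup :=
  (w.map fun a => G.gen a.toGen).prod

/-- The product in the inverse semigroup of the contraction of the image of a word. -/
noncomputable def evalHat (G : DirectedMultigraph V E) (w : List (Letter E)) :
    G.contraction.InvSemigroup :=
  (w.map fun a => G.contraction.gen (G.hat a)).prod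

@[simp] lemma eval_nil : G.eval [] = 1 := rfl
@[simp] lemma evalHat_nil : G.evalHat [] = 1 := rfl
@[simp] lemma eval_cons (a : Letter E) (w : List (Letter E)) :
    G.eval (a :: w) = G.gen a.toGen * G.eval w := by simp [eval]
@[simp] lemma evalHat_cons (a : Letter E) (w : List (Letter E)) :
    G.evalHat (a :: w) = G.contraction.gen (G.hat a) * G.evalHat w := by simp [evalHat]
@[simp] lemma eval_append (w w' : List (Letter E)) :
    G.eval (w ++ w') = G.eval w * G.eval w' := by simp [eval]
@[simp] lemma evalHat_append (w w' : List (Letter E)) :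
    G.evalHat (w ++ w') = G.evalHat w * G.evalHat w' := by simp [evalHat]

lemma eval_ne_zero_of_append {w₁ w₂ w₃ : List (Letter E)}
    (h : G.eval (w₁ ++ w₂ ++ w₃) ≠ G.gen .zero) : G.eval w₂ ≠ G.gen .zero := by
  intro h0
  apply h
  rw [eval_append, eval_append, h0, mul_gen_zero, gen_zero_mul]

/-! ### Dyck words and ascents -/

/-- The words that reduce to the idempotent of the vertex `v`. -/
inductive IsDyck (G : DirectedMultigraph V E) : V → List (Letter E) → Prop
  | nil (v : V) : IsDyck G v []
  | cons {v : V} (f : E) {A B : List (Letter E)} : G.src f = v → IsDyck G (G.tgt f) A →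
      IsDyck G v B → IsDyck G v (.neg f :: (A ++ .pos f :: B))

/-- The words `D₀ f₁⁻ D₁ f₂⁻ ⋯ Dₙ₋₁ fₙ⁻`, where the path `f₁ f₂ ⋯ fₙ` starts at `v`
and the `Dᵢ` are Dyck words. -/
def IsAscent (G : DirectedMultigraph V E) : V → List E → List (Letter E) → Prop
  | _, [], w => w = []
  | v, f :: q, w => G.src f = v ∧
      ∃ A B, G.IsDyck v A ∧ IsAscent G (G.tgt f) q B ∧ w = A ++ .neg f :: B

/-- The words with nonzero product that start at `v`: the edges of `p` are popped first, then the
edges of `q` are pushed. -/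
inductive HasNormalForm (G : DirectedMultigraph V E) : V → List E → List E → List (Letter E) → Prop
  | dyck {v : V} {w : List (Letter E)} : G.IsDyck v w → HasNormalForm G v [] [] w
  | push {v : V} {f : E} {q : List E} {A B : List (Letter E)} : G.src f = v → G.IsDyck v A →
      HasNormalForm G (G.tgt f) [] q B → HasNormalForm G v [] (f :: q) (A ++ .neg f :: B)
  | pop {v : V} {f : E} {p q : List E} {A B : List (Letter E)} : G.tgt f = v → G.IsDyck v A →
      HasNormalForm G (G.src f) p q B → HasNormalForm G v (f :: p) q (A ++ .pos f :: B)

lemma IsDyck.append {v : V} {A B : List (Letter E)} (hA : G.IsDyck v A) (hB : G.IsDyck v B) :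
    G.IsDyck v (A ++ B) := by
  induction hA with
  | nil v => exact hB
  | cons f hf h1 h2 _ ih2 =>
    have := IsDyck.cons f hf h1 (ih2 hB)
    simpa using this

lemma HasNormalForm.dyck_append {v : V} {p q : List E} {A B : List (Letter E)}
    (hA : G.IsDyck v A) (hB : G.HasNormalForm v p q B) : G.HasNormalForm v p q (A ++ B) := by
  cases hB with
  | dyck h => exact .dyck (hA.append h)
  | push h1 h2 h3 => rw [← List.append_assoc]; exact .push h1 (hA.append h2) h3
  | pop h1 h2 h3 => rw [← List.append_assoc]; exact .pop h1 (hA.append h2) h3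

lemma idem_mul_neg (f : E) : G.gen (.idem (G.src f)) * G.gen (.neg f) = G.gen (.neg f) :=
  gen_mul_gen (.src_neg f)

lemma neg_mul_idem (f : E) : G.gen (.neg f) * G.gen (.idem (G.tgt f)) = G.gen (.neg f) :=
  gen_mul_gen (.neg_tgt f)

lemma idem_mul_pos (f : E) : G.gen (.idem (G.tgt f)) * G.gen (.pos f) = G.gen (.pos f) :=
  gen_mul_gen (.tgt_pos f)

lemma pos_mul_idem (f : E) : G.gen (.pos f) * G.gen (.idem (G.src f)) = G.gen (.pos f) :=
  gen_mul_gen (.pos_src f)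

lemma neg_mul_pos (f : E) : G.gen (.neg f) * G.gen (.pos f) = G.gen (.idem (G.src f)) :=
  gen_mul_gen (.neg_pos_self f)

/-- The inner Dyck word acts as an idempotent absorbed by the preceding `f⁻`, after which `f⁻ f⁺`
cancels. -/
lemma IsDyck.idem_mul_eval {v : V} {A : List (Letter E)} (hA : G.IsDyck v A) :
    G.gen (.idem v) * G.eval A = G.gen (.idem v) := by
  induction hA with
  | nil v => exact mul_one _
  | @cons v f A B hf _ _ ih1 ih2 =>
    subst hf
    simp only [eval_cons, eval_append, Letter.toGen]
    calc _ = G.gen (.idem (G.src f)) * G.gen (.neg f) * G.eval A * G.gen (.pos f) * G.eval B := by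
          simp only [mul_assoc]
      _ = G.gen (.neg f) * (G.gen (.idem (G.tgt f)) * G.eval A) * G.gen (.pos f) * G.eval B := by
          rw [idem_mul_neg, ← mul_assoc, neg_mul_idem]
      _ = _ := by rw [ih1, neg_mul_idem, neg_mul_pos, ih2]

/-- Letters are added on the left. A new push stays unmatched unless the rest begins, after a Dyck
word, with a pop; that pop must then be of the same edge, since otherwise the product vanishes. -/
lemma exists_hasNormalForm {w : List (Letter E)} : ∀ {v : V},
    G.gen (.idem v) * G.eval w ≠ G.gen .zero → ∃ p q, G.HasNormalForm v p q w := by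
  induction w with
  | nil => exact fun {v} _ => ⟨[], [], .dyck (.nil v)⟩
  | cons a w ih =>
    intro v h
    rw [eval_cons] at h
    cases a with
    | neg f =>
      simp only [Letter.toGen] at h
      have hv : G.src f = v := by
        by_contra hv
        apply h
        rw [← idem_mul_neg, mul_assoc, ← mul_assoc (G.gen (.idem v)),
          gen_mul_gen (.idem_ne v _ (Ne.symm hv)), gen_zero_mul]
      subst hv
      rw [← mul_assoc, idem_mul_neg] at h
      have h' : G.gen (.idem (G.tgt f)) * G.eval w ≠ G.gen .zero := by
        intro h0
        apply h
        rw [← neg_mul_idem, mul_assoc, h0, mul_gen_zero]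
      obtain ⟨p, q, hn⟩ := ih h'
      cases hn with
      | dyck hw => exact ⟨[], [f], .push (A := []) rfl (.nil _) (.dyck hw)⟩
      | push h1 h2 h3 => exact ⟨[], _, .push (A := []) rfl (.nil _) (.push h1 h2 h3)⟩
      | @pop _ g p q A B h1 h2 h3 =>
        have hfg : f = g := by
          by_contra hfg
          apply h
          rw [← neg_mul_idem]
          simp only [eval_append, eval_cons, Letter.toGen]
          calc _ = G.gen (.neg f) * (G.gen (.idem (G.tgt f)) * G.eval A) * G.gen (.pos g)
                * G.eval B := by simp only [mul_assoc]
            _ = _ := by rw [h2.idem_mul_eval, neg_mul_idem, gen_mul_gen (.neg_pos_ne _ _ hfg),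
                  gen_zero_mul]
        subst hfg
        have := HasNormalForm.dyck_append (.cons f rfl h2 (.nil _)) h3
        exact ⟨p, q, by simpa using this⟩
    | pos f =>
      simp only [Letter.toGen] at h
      have hv : G.tgt f = v := by
        by_contra hv
        apply h
        rw [← idem_mul_pos, mul_assoc, ← mul_assoc (G.gen (.idem v)),
          gen_mul_gen (.idem_ne v _ (Ne.symm hv)), gen_zero_mul]
      subst hv
      rw [← mul_assoc, idem_mul_pos] at h
      have h' : G.gen (.idem (G.src f)) * G.eval w ≠ G.gen .zero := by
        intro h0
        apply h
        rw [← pos_mul_idem, mul_assoc, h0, mul_gen_zero]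
      obtain ⟨p, q, hn⟩ := ih h'
      exact ⟨f :: p, q, .pop (A := []) rfl (.nil _) hn⟩

lemma IsDyck.run_eval {v : V} {A : List (Letter E)} (hA : G.IsDyck v A) (l : List E) :
    G.run (G.eval A) (some (v, l)) = some (v, l) := by
  have := congrArg (G.run · (some (v, l))) hA.idem_mul_eval
  simpa only [run_mul, run_idem] using this

/-- An ascent never pops below its starting level, so it runs on any stack over `v`. -/
lemma IsAscent.run_eval_ne_none {q : List E} : ∀ {v : V} {w : List (Letter E)} (l : List E),
    G.IsAscent v q w → G.run (G.eval w) (some (v, l)) ≠ none := by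
  induction q with
  | nil => rintro v w l rfl; simp [run_one]
  | cons f q ih =>
    rintro v w l ⟨rfl, A, B, hA, hB, rfl⟩
    rw [eval_append, eval_cons, run_mul, run_mul, hA.run_eval, Letter.toGen, run_neg]
    exact ih _ hB

lemma IsAscent.append {q q' : List E} : ∀ {v u : V} {w w' : List (Letter E)},
    G.IsPath Set.univ v u q → G.IsAscent v q w → G.IsAscent u q' w' →
      G.IsAscent v (q ++ q') (w ++ w') := by
  induction q with
  | nil => rintro v u w w' rfl rfl h; exact h
  | cons f q ih =>
    rintro v u w w' ⟨-, -, hp⟩ ⟨hf, A, B, hA, hB, rfl⟩ h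
    exact ⟨hf, A, B ++ w', hA, ih hp hB h, by simp⟩

lemma IsAscent.exists_isPath {q : List E} : ∀ {v : V} {w : List (Letter E)},
    G.IsAscent v q w → ∃ u, G.IsPath Set.univ v u q := by
  induction q with
  | nil => exact fun {v w} _ => ⟨v, rfl⟩
  | cons f q ih =>
    rintro v w ⟨hf, A, B, hA, hB, rfl⟩
    obtain ⟨u, hu⟩ := ih hB
    exact ⟨u, trivial, hf, hu⟩

/-! ### Weights -/

/-- The weight of a word: pushing the edge `e` contributes `φ e` and popping it `-φ e`. -/
def weight (φ : E → ℕ) (w : List (Letter E)) : ℤ :=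
  (w.map fun a => match a with
    | .neg e => (φ e : ℤ)
    | .pos e => -(φ e : ℤ)).sum

lemma prefix_append_cases {α : Type*} {X A B : List α} (h : X <+: A ++ B) :
    X <+: A ∨ ∃ Z, X = A ++ Z ∧ Z <+: B := by
  obtain ⟨Y, hY⟩ := h
  rcases List.append_eq_append_iff.1 hY with ⟨Z, h1, h2⟩ | ⟨Z, h1, h2⟩
  · exact .inl ⟨Z, h1.symm⟩
  · exact .inr ⟨Z, h1, ⟨Y, h2.symm⟩⟩

section
variable (φ : E → ℕ)

@[simp] lemma weight_nil : weight φ [] = 0 := rfl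
@[simp] lemma weight_neg_cons (e : E) (w : List (Letter E)) :
    weight φ (.neg e :: w) = φ e + weight φ w := by simp [weight]
@[simp] lemma weight_pos_cons (e : E) (w : List (Letter E)) :
    weight φ (.pos e :: w) = -φ e + weight φ w := by simp [weight]
@[simp] lemma weight_append (w w' : List (Letter E)) :
    weight φ (w ++ w') = weight φ w + weight φ w' := by simp [weight]

lemma IsDyck.weight_eq {v : V} {A : List (Letter E)} (hA : G.IsDyck v A) : weight φ A = 0 := by
  induction hA with
  | nil => rfl
  | cons f _ _ _ ih1 ih2 => simp [ih1, ih2]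

lemma IsDyck.weight_prefix_nonneg {v : V} {A : List (Letter E)} (hA : G.IsDyck v A) :
    ∀ {X : List (Letter E)}, X <+: A → 0 ≤ weight φ X := by
  induction hA with
  | nil => intro X hX; simp [List.prefix_nil.1 hX]
  | @cons v f A B _ h1 _ ih1 ih2 =>
    intro X hX
    rcases List.prefix_cons_iff.1 hX with rfl | ⟨Y, rfl, hY⟩
    · simp
    rw [weight_neg_cons]
    rcases prefix_append_cases hY with hY | ⟨Z, rfl, hZ⟩
    · have := ih1 hY; positivity
    rcases List.prefix_cons_iff.1 hZ with rfl | ⟨W, rfl, hW⟩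
    · simp [h1.weight_eq]
    · have := ih2 hW
      simp [h1.weight_eq, this]

lemma IsAscent.weight_eq {q : List E} : ∀ {v : V} {w : List (Letter E)},
    G.IsAscent v q w → weight φ w = ((q.map φ).sum : ℕ) := by
  induction q with
  | nil => rintro v w rfl; rfl
  | cons f q ih =>
    rintro v w ⟨hf, A, B, hA, hB, rfl⟩
    simp [hA.weight_eq, ih hB]

lemma IsAscent.weight_prefix_nonneg {q : List E} : ∀ {v : V} {w X : List (Letter E)},
    G.IsAscent v q w → X <+: w → 0 ≤ weight φ X := by
  induction q with
  | nil => rintro v w X rfl hX; simp [List.prefix_nil.1 hX]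
  | cons f q ih =>
    rintro v w X ⟨hf, A, B, hA, hB, rfl⟩ hX
    rcases prefix_append_cases hX with hY | ⟨Z, rfl, hZ⟩
    · exact hA.weight_prefix_nonneg φ hY
    rcases List.prefix_cons_iff.1 hZ with rfl | ⟨W, rfl, hW⟩
    · simp [hA.weight_eq]
    · have := ih hB hW
      simp only [weight_append, hA.weight_eq, weight_neg_cons]
      positivity

end

/-- With unit weights the total is zero, so removing a final push would leave a prefix of weight
`-1`. -/
lemma IsDyck.concat_neg_false {v : V} {A : List (Letter E)} {e : E}
    (h : G.IsDyck v (A ++ [.neg e])) : False := by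
  have h1 := h.weight_prefix_nonneg (fun _ => 1) (List.prefix_append _ _)
  have h2 := h.weight_eq (fun _ => 1)
  simp at h1 h2
  omega

/-! ### Paths and the tree -/

lemma IsPath.append {S : Set E} {p q : List E} : ∀ {u v x : V},
    G.IsPath S u v p → G.IsPath S v x q → G.IsPath S u x (p ++ q) := by
  induction p with
  | nil => rintro u v x rfl h; exact h
  | cons f p ih => rintro u v x ⟨h1, h2, h3⟩ h; exact ⟨h1, h2, ih h3 h⟩

lemma IsPath.mono {S T : Set E} (hST : S ⊆ T) {p : List E} : ∀ {u v : V},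
    G.IsPath S u v p → G.IsPath T u v p := by
  induction p with
  | nil => rintro u v rfl; rfl
  | cons f p ih => rintro u v ⟨h1, h2, h3⟩; exact ⟨hST h1, h2, ih h3⟩

lemma IsPath.mem {S : Set E} {p : List E} : ∀ {u v : V},
    G.IsPath S u v p → ∀ f ∈ p, f ∈ S := by
  induction p with
  | nil => simp
  | cons f p ih =>
    rintro u v ⟨h1, h2, h3⟩
    simpa using ⟨h1, ih h3⟩

lemma IsPath.concat {S : Set E} {p : List E} {u : V} {f : E} (h : G.IsPath S u (G.src f) p)
    (hf : f ∈ S) : G.IsPath S u (G.tgt f) (p ++ [f]) :=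
  h.append ⟨hf, rfl, rfl⟩

lemma IsPath.exists_last {S : Set E} {p : List E} : ∀ {u v : V},
    G.IsPath S u v p → u ≠ v → ∃ f ∈ S, G.tgt f = v := by
  induction p with
  | nil => rintro u v rfl h; exact absurd rfl h
  | cons f p ih =>
    rintro u v ⟨h1, h2, h3⟩ -
    by_cases h : G.tgt f = v
    · exact ⟨f, h1, h⟩
    · exact ih h3 h

/-- A vertex other than the root is entered by a tree edge, which by definition of `treeEdges` is
its only incoming edge. -/
lemma IsTreeWithRoot.tgt_eq (hr : G.IsTreeWithRoot r) {e : E} (he : e ∉ G.treeEdges) :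
    G.tgt e = r := by
  by_contra h
  obtain ⟨p, hp, -⟩ := hr (G.tgt e)
  obtain ⟨f, hf, hfe⟩ := hp.exists_last (Ne.symm h)
  exact he (hf e hfe.symm ▸ hf)

/-- Otherwise the root would have a nonempty closed tree path besides the empty one. -/
lemma IsTreeWithRoot.tgt_ne (hr : G.IsTreeWithRoot r) {f : E} (hf : f ∈ G.treeEdges) :
    G.tgt f ≠ r := by
  intro h
  obtain ⟨p, hp, -⟩ := hr (G.src f)
  have h1 := h ▸ hp.concat hf
  have := (hr r).unique h1 (show G.IsPath G.treeEdges r r [] from rfl)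
  simp at this

lemma IsPath.subtreeOf_eq {p : List E} : ∀ {u v : V},
    G.IsPath G.treeEdges u v p → G.subtreeOf u = G.subtreeOf v := by
  induction p with
  | nil => rintro u v rfl; rfl
  | cons f p ih =>
    rintro u v ⟨h1, h2, h3⟩
    rw [← ih h3]
    exact Quot.sound ⟨f, h1, h2, rfl⟩

lemma IsTreeWithRoot.subtreeOf_eq (hr : G.IsTreeWithRoot r) (v : V) :
    G.subtreeOf v = G.subtreeOf r := by
  obtain ⟨p, hp, -⟩ := hr v
  exact hp.subtreeOf_eq.symm

/-! ### Images of words in the inverse semigroup of the contraction -/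

lemma hat_neg_of_mem {f : E} (hf : f ∈ G.treeEdges) :
    G.hat (.neg f) = .idem (G.subtreeOf (G.src f)) := by simp [hat, hf]

lemma hat_pos_of_mem {f : E} (hf : f ∈ G.treeEdges) :
    G.hat (.pos f) = .idem (G.subtreeOf (G.src f)) := by simp [hat, hf]

lemma hat_neg_of_notMem {f : E} (hf : f ∉ G.treeEdges) : G.hat (.neg f) = .neg ⟨f, hf⟩ := by
  simp [hat, hf]

lemma hat_pos_of_notMem {f : E} (hf : f ∉ G.treeEdges) : G.hat (.pos f) = .pos ⟨f, hf⟩ := by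
  simp [hat, hf]

/-- The idempotent in the inverse semigroup of the contraction at the subtree of `r`. -/
noncomputable def rootIdem (G : DirectedMultigraph V E) (r : V) : G.contraction.InvSemigroup :=
  G.contraction.gen (.idem (G.subtreeOf r))

lemma rootIdem_mul_self : G.rootIdem r * G.rootIdem r = G.rootIdem r :=
  gen_mul_gen (.idem_self _)

lemma IsTreeWithRoot.rootIdem_mul_hat_neg (hr : G.IsTreeWithRoot r) (f : E) :
    G.rootIdem r * G.contraction.gen (G.hat (.neg f)) = G.contraction.gen (G.hat (.neg f)) := by
  by_cases hf : f ∈ G.treeEdges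
  · rw [hat_neg_of_mem hf, hr.subtreeOf_eq]
    exact rootIdem_mul_self
  · rw [hat_neg_of_notMem hf, rootIdem, ← hr.subtreeOf_eq (G.src f)]
    exact idem_mul_neg (G := G.contraction) _

lemma IsTreeWithRoot.hat_neg_mul_rootIdem (hr : G.IsTreeWithRoot r) (f : E) :
    G.contraction.gen (G.hat (.neg f)) * G.rootIdem r = G.contraction.gen (G.hat (.neg f)) := by
  by_cases hf : f ∈ G.treeEdges
  · rw [hat_neg_of_mem hf, hr.subtreeOf_eq]
    exact rootIdem_mul_self
  · rw [hat_neg_of_notMem hf, rootIdem, ← hr.subtreeOf_eq (G.tgt f)]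
    exact neg_mul_idem (G := G.contraction) _

lemma IsTreeWithRoot.hat_neg_mul_hat_pos (hr : G.IsTreeWithRoot r) (f : E) :
    G.contraction.gen (G.hat (.neg f)) * G.contraction.gen (G.hat (.pos f)) = G.rootIdem r := by
  by_cases hf : f ∈ G.treeEdges
  · rw [hat_neg_of_mem hf, hat_pos_of_mem hf, hr.subtreeOf_eq]
    exact rootIdem_mul_self
  · rw [hat_neg_of_notMem hf, hat_pos_of_notMem hf, rootIdem, ← hr.subtreeOf_eq (G.src f)]
    exact neg_mul_pos (G := G.contraction) _

lemma IsDyck.rootIdem_mul_evalHat (hr : G.IsTreeWithRoot r) {v : V} {A : List (Letter E)}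
    (hA : G.IsDyck v A) : G.rootIdem r * G.evalHat A = G.rootIdem r := by
  induction hA with
  | nil v => exact mul_one _
  | @cons v f A B hf _ _ ih1 ih2 =>
    simp only [evalHat_cons, evalHat_append]
    rw [← mul_assoc, hr.rootIdem_mul_hat_neg, ← hr.hat_neg_mul_rootIdem, mul_assoc,
      ← mul_assoc (G.rootIdem r), ih1, ← mul_assoc, hr.hat_neg_mul_rootIdem, ← mul_assoc,
      hr.hat_neg_mul_hat_pos, ih2]

lemma IsDyck.run_evalHat (hr : G.IsTreeWithRoot r) {v : V} {A : List (Letter E)}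
    (hA : G.IsDyck v A) (l : List {e : E // e ∉ G.treeEdges}) :
    G.contraction.run (G.evalHat A) (some (G.subtreeOf r, l)) = some (G.subtreeOf r, l) := by
  have := congrArg (G.contraction.run · (some (G.subtreeOf r, l))) (hA.rootIdem_mul_evalHat hr)
  simpa only [run_mul, rootIdem, run_idem] using this

lemma IsTreeWithRoot.run_neg (hr : G.IsTreeWithRoot r) (e : {e : E // e ∉ G.treeEdges})
    (l : List {e : E // e ∉ G.treeEdges}) :
    G.contraction.run (G.contraction.gen (.neg e)) (some (G.subtreeOf r, l)) =
      some (G.subtreeOf r, e :: l) := by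
  have := DirectedMultigraph.run_neg (G := G.contraction) e l
  simpa only [contraction, hr.subtreeOf_eq] using this

lemma IsTreeWithRoot.run_hat_neg_of_mem (hr : G.IsTreeWithRoot r) {f : E} (hf : f ∈ G.treeEdges)
    (l : List {e : E // e ∉ G.treeEdges}) :
    G.contraction.run (G.contraction.gen (G.hat (.neg f))) (some (G.subtreeOf r, l)) =
      some (G.subtreeOf r, l) := by
  rw [hat_neg_of_mem hf, hr.subtreeOf_eq, run_idem]

/-- Dyck factors and tree edges act trivially after contraction. Only the set of stacked edges is
recorded, since this suffices to recognize a power of `ê⁻`. -/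
lemma HasNormalForm.run_evalHat_of_pushes (hr : G.IsTreeWithRoot r) {v : V} {p q : List E}
    {w : List (Letter E)} (h : G.HasNormalForm v p q w) (hp : p = [])
    (l : List {e : E // e ∉ G.treeEdges}) :
    ∃ l', G.contraction.run (G.evalHat w) (some (G.subtreeOf r, l)) =
      some (G.subtreeOf r, l' ++ l) ∧ ∀ g, g ∈ l' ↔ g.1 ∈ q := by
  induction h generalizing l with
  | dyck h => exact ⟨[], h.run_evalHat hr l, by simp⟩
  | @push v f q A B hf hA _ ih =>
    rw [evalHat_append, evalHat_cons, run_mul, run_mul, hA.run_evalHat hr]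
    by_cases hft : f ∈ G.treeEdges
    · rw [hr.run_hat_neg_of_mem hft]
      obtain ⟨l', h1, h2⟩ := ih rfl l
      refine ⟨l', h1, fun g => ?_⟩
      have : g.1 ≠ f := fun h => g.2 (h ▸ hft)
      simp [h2, this]
    · rw [hat_neg_of_notMem hft, hr.run_neg]
      obtain ⟨l', h1, h2⟩ := ih rfl (⟨f, hft⟩ :: l)
      refine ⟨l' ++ [⟨f, hft⟩], by simpa using h1, fun g => ?_⟩
      simp [h2, Subtype.ext_iff, or_comm]
  | pop => simp at hp

/-- Starting from the empty stack, an unmatched pop of an edge outside the tree is fatal. -/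
lemma HasNormalForm.run_evalHat (hr : G.IsTreeWithRoot r) {v : V} {p q : List E}
    {w : List (Letter E)} (h : G.HasNormalForm v p q w)
    (hw : G.contraction.run (G.evalHat w) (some (G.subtreeOf r, [])) ≠ none) :
    (∀ f ∈ p, f ∈ G.treeEdges) ∧ ∃ l', G.contraction.run (G.evalHat w)
      (some (G.subtreeOf r, [])) = some (G.subtreeOf r, l') ∧ ∀ g, g ∈ l' ↔ g.1 ∈ q := by
  induction h with
  | dyck h => exact ⟨by simp, by simpa using (HasNormalForm.dyck h).run_evalHat_of_pushes hr rfl []⟩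
  | push h1 h2 h3 =>
    exact ⟨by simp, by simpa using (HasNormalForm.push h1 h2 h3).run_evalHat_of_pushes hr rfl []⟩
  | @pop v f p q A B hf hA _ ih =>
    rw [evalHat_append, evalHat_cons, run_mul, run_mul, hA.run_evalHat hr] at hw ⊢
    by_cases hft : f ∈ G.treeEdges
    · rw [hat_pos_of_mem hft, hr.subtreeOf_eq, run_idem] at hw ⊢
      obtain ⟨h1, h2⟩ := ih hw
      exact ⟨by simpa using ⟨hft, h1⟩, h2⟩
    · rw [hat_pos_of_notMem hft, run_gen] at hw
      exact absurd (run_none _) hw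

/-- The cut is at the last unmatched `e⁻`; nothing after it pops below the level reached there. -/
lemma HasNormalForm.exists_split {v : V} {p q : List E} {w : List (Letter E)} {e : E}
    (h : G.HasNormalForm v p q w) (he : e ∈ q) :
    ∃ A B q', w = A ++ .neg e :: B ∧ G.HasNormalForm (G.tgt e) [] q' B ∧ q' ⊆ q ∧ e ∉ q' := by
  induction h with
  | dyck h => simp at he
  | @push v f q A B hf hA hB ih =>
    by_cases heq : e ∈ q
    · obtain ⟨A', B', q', rfl, h2, h3, h4⟩ := ih heq
      exact ⟨A ++ .neg f :: A', B', q', by simp, h2, List.Subset.trans h3 (List.subset_cons_self _ _), h4⟩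
    · obtain rfl : e = f := by simpa [heq] using he
      exact ⟨A, B, q, rfl, hB, by simp, heq⟩
  | @pop v f p q A B hf hA hB ih =>
    obtain ⟨A', B', q', rfl, h2, h3, h4⟩ := ih he
    exact ⟨A ++ .pos f :: A', B', q', by simp, h2, h3, h4⟩

/-- A normal form without pops is an ascent followed by a Dyck word. The final letter `e⁻` forces
that trailing Dyck word to be empty. -/
lemma HasNormalForm.isAscent {v : V} {p q : List E} {w w₀ : List (Letter E)} {e : E}
    (h : G.HasNormalForm v p q w) (hp : p = []) (hw : w = w₀ ++ [.neg e]) :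
    G.IsAscent v q w ∧ ∃ q₀, q = q₀ ++ [e] := by
  induction h generalizing w₀ with
  | dyck h => exact (hw ▸ h).concat_neg_false.elim
  | @push v f q A B hf hA hB ih =>
    rcases List.eq_nil_or_concat B with rfl | ⟨B₀, b, rfl⟩
    · have hfe : f = e := by
        have := (List.append_inj' hw rfl).2
        simpa using this
      subst hfe
      generalize hB0 : ([] : List (Letter E)) = B at hB
      cases hB with
      | dyck _ => subst hB0; exact ⟨⟨hf, A, [], hA, rfl, rfl⟩, [], rfl⟩
      | push _ _ _ => simp at hB0
    · have hw' : (A ++ .neg f :: B₀) ++ [b] = w₀ ++ [.neg e] := by simpa using hw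
      have hb := (List.append_inj' hw' rfl).2
      obtain ⟨h1, q₀, rfl⟩ := ih (w₀ := B₀) rfl (by simpa using hb)
      exact ⟨⟨hf, A, _, hA, h1, rfl⟩, f :: q₀, rfl⟩
  | pop => simp at hp

/-- Each passage through `e` returns to the root, and the next stretch is a tree path to the source
of `e`, hence equal to `T` by uniqueness. In the induction `t` is the tree path covered since the
last visit to the root. -/
lemma IsTreeWithRoot.path_eq_flatten (hr : G.IsTreeWithRoot r) {e : E} (he : e ∉ G.treeEdges)
    {T : List E} (hT : G.IsPath G.treeEdges r (G.src e) T) {q : List E} : ∀ {q₀ t : List E}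
    {v u : V}, G.IsPath G.treeEdges r v t → G.IsPath Set.univ v u q → q = q₀ ++ [e] →
      (∀ f ∈ q, f ∉ G.treeEdges → f = e) →
      ∃ m, 0 < m ∧ t ++ q = (List.replicate m (T ++ [e])).flatten := by
  induction q with
  | nil => simp
  | cons f q ih =>
    rintro q₀ t v u ht ⟨-, rfl, hq⟩ hq0 hmem
    have hmem' : ∀ g ∈ q, g ∉ G.treeEdges → g = e := fun g hg => hmem g (by simp [hg])
    by_cases hf : f ∈ G.treeEdges
    · rcases List.cons_eq_append_iff.1 hq0 with ⟨-, h⟩ | ⟨q₁, -, h⟩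
      · simp only [List.cons.injEq] at h
        exact absurd (h.1 ▸ hf) he
      · obtain ⟨m, hm, h⟩ := ih (ht.concat hf) hq h hmem'
        exact ⟨m, hm, by simpa using h⟩
    · obtain rfl : f = e := hmem f (by simp) hf
      obtain rfl : t = T := (hr _).unique ht hT
      rcases List.cons_eq_append_iff.1 hq0 with ⟨-, h⟩ | ⟨q₁, -, h⟩
      · simp only [List.cons.injEq, true_and] at h
        exact ⟨1, one_pos, by simp [h]⟩
      · obtain ⟨m, hm, h⟩ := ih (v := G.tgt f) (t := []) (hr.tgt_eq hf).symm hq h hmem'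
        refine ⟨m + 1, by omega, ?_⟩
        rw [List.replicate_succ, List.flatten_cons, ← h]
        simp

lemma IsAscent.rootIdem_mul_evalHat (hr : G.IsTreeWithRoot r) {q : List E} : ∀ {v : V}
    {w : List (Letter E)}, G.IsAscent v q w → G.rootIdem r * G.evalHat w =
      G.rootIdem r * G.evalHat (q.map .neg) := by
  induction q with
  | nil => rintro v w rfl; rfl
  | cons f q ih =>
    rintro v w ⟨hf, A, B, hA, hB, rfl⟩
    rw [evalHat_append, ← mul_assoc, hA.rootIdem_mul_evalHat hr, evalHat_cons, List.map_cons,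
      evalHat_cons, ← hr.hat_neg_mul_rootIdem, mul_assoc, ih hB, mul_assoc]

lemma IsTreeWithRoot.rootIdem_mul_evalHat_tree (hr : G.IsTreeWithRoot r) {T : List E}
    (hT : ∀ f ∈ T, f ∈ G.treeEdges) :
    G.rootIdem r * G.evalHat (T.map .neg) = G.rootIdem r := by
  induction T with
  | nil => exact mul_one _
  | cons f T ih =>
    rw [List.map_cons, evalHat_cons, hat_neg_of_mem (hT f (by simp)), hr.subtreeOf_eq, ← rootIdem,
      ← mul_assoc, rootIdem_mul_self, ih fun g hg => hT g (by simp [hg])]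

lemma IsTreeWithRoot.rootIdem_mul_evalHat_flatten (hr : G.IsTreeWithRoot r)
    (e : {e : E // e ∉ G.treeEdges}) {T : List E} (hT : ∀ f ∈ T, f ∈ G.treeEdges) (m : ℕ) :
    G.rootIdem r * G.evalHat ((List.replicate m (T ++ [e.1])).flatten.map .neg) =
      G.rootIdem r * G.contraction.gen (.neg e) ^ m := by
  have h1 := hr.rootIdem_mul_hat_neg e.1
  have h2 := hr.hat_neg_mul_rootIdem e.1
  rw [hat_neg_of_notMem e.2] at h1 h2
  induction m with
  | zero => simp
  | succ m ih =>
    rw [List.replicate_succ, List.flatten_cons, List.map_append, List.map_append, evalHat_append,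
      evalHat_append, ← mul_assoc, ← mul_assoc, hr.rootIdem_mul_evalHat_tree hT, List.map_singleton,
      evalHat_cons, evalHat_nil, mul_one, hat_neg_of_notMem e.2, pow_succ', ← mul_assoc, h1,
      ← h2, mul_assoc, ih, ← mul_assoc, h2]

/-- The identities above hold only after multiplication by the root idempotent. It can be removed
because both sides begin with a push, which absorbs it; for the power this needs `0 < m`. -/
lemma IsAscent.evalHat_eq (hr : G.IsTreeWithRoot r) (e : {e : E // e ∉ G.treeEdges}) {T : List E}
    (hT : ∀ f ∈ T, f ∈ G.treeEdges) {m : ℕ} (hm : 0 < m) {v : V} {w : List (Letter E)}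
    (hw : G.IsAscent v (List.replicate m (T ++ [e.1])).flatten w) :
    G.evalHat w = G.contraction.gen (.neg e) ^ m := by
  have h1 := hr.rootIdem_mul_hat_neg e.1
  rw [hat_neg_of_notMem e.2] at h1
  have h := hw.rootIdem_mul_evalHat hr
  rw [hr.rootIdem_mul_evalHat_flatten e hT] at h
  obtain ⟨m, rfl⟩ := Nat.exists_eq_succ_of_ne_zero hm.ne'
  rw [pow_succ', ← mul_assoc, h1, ← pow_succ'] at h
  rw [← h]
  obtain ⟨q, f, hq⟩ : ∃ f q, (List.replicate (m + 1) (T ++ [e.1])).flatten = f :: q := by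
    rw [List.replicate_succ]; rcases T with _ | ⟨f, T⟩ <;> simp
  rw [hq] at hw
  obtain ⟨-, A, B, hA, -, rfl⟩ := hw
  cases hA with
  | nil => simp only [List.nil_append, evalHat_cons]; rw [← mul_assoc, hr.rootIdem_mul_hat_neg]
  | cons => simp only [List.cons_append, evalHat_cons]; rw [← mul_assoc, hr.rootIdem_mul_hat_neg]

/-! ### Windows of bi-infinite sequences -/

section Window
variable {A : Type*}

/-- The word of length `n` that appears in `x` at position `i`. -/
def window (x : ℤ → A) (i : ℤ) (n : ℕ) : List A := (List.range n).map fun j : ℕ => x (i + j)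

@[simp] lemma length_window (x : ℤ → A) (i : ℤ) (n : ℕ) : (window x i n).length = n := by
  simp [window]

lemma window_add (x : ℤ → A) (i : ℤ) (m n : ℕ) :
    window x i (m + n) = window x i m ++ window x (i + m) n := by
  simp [window, List.range_add, Function.comp_def, add_assoc]

lemma window_succ (x : ℤ → A) (i : ℤ) (n : ℕ) :
    window x i (n + 1) = x i :: window x (i + 1) n := by
  rw [add_comm n 1, window_add]
  simp [window]

lemma window_ext {x y : ℤ → A} {i j : ℤ} {n : ℕ} (h : ∀ t : ℕ, t < n → x (i + t) = y (j + t)) :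
    window x i n = window y j n :=
  List.map_congr_left fun t ht => h t (List.mem_range.1 ht)

lemma apply_eq_of_window_eq {x y : ℤ → A} {i j : ℤ} {n : ℕ} (h : window x i n = window y j n)
    {t : ℕ} (ht : t < n) : x (i + t) = y (j + t) :=
  List.map_inj_left.1 h t (List.mem_range.2 ht)

lemma shift_iterate (x : ℤ → A) (n : ℕ) : shift^[n] x = fun i => x (i + n) := by
  induction n generalizing x with
  | zero => simp
  | succ n ih =>
    rw [Function.iterate_succ_apply, ih]
    funext i
    simp [shift, add_assoc]

lemma isPeriodicPt_shift_iff {x : ℤ → A} {k : ℕ} :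
    Function.IsPeriodicPt shift k x ↔ Function.Periodic x (k : ℤ) := by
  rw [Function.IsPeriodicPt, Function.IsFixedPt, shift_iterate, funext_iff]
  rfl

lemma apply_emod {x : ℤ → A} {k : ℕ} (hx : Function.Periodic x (k : ℤ)) (i : ℤ) :
    x (i % k) = x i := by
  conv_rhs => rw [← Int.emod_add_mul_ediv i k, mul_comm]
  exact ((hx.int_mul (i / k)) (i % k)).symm

lemma window_emod {x : ℤ → A} {k : ℕ} (hx : Function.Periodic x (k : ℤ)) (i : ℤ) (n : ℕ) :
    window x (i % k) n = window x i n :=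
  window_ext fun t _ => by
    rw [← apply_emod hx (i % k + t), Int.emod_add_emod, apply_emod hx]

lemma window_add_period {x : ℤ → A} {k : ℕ} (hx : Function.Periodic x (k : ℤ)) (i : ℤ) (n : ℕ) :
    window x (i + k) n = window x i n :=
  window_ext fun t _ => by rw [add_right_comm, hx]

lemma window_mul {x : ℤ → A} {k : ℕ} (hx : Function.Periodic x (k : ℤ)) (i : ℤ) (t : ℕ) :
    window x i (k * t) = (List.replicate t (window x i k)).flatten := by
  induction t with
  | zero => simp [window]
  | succ t ih =>
    rw [mul_add_one, add_comm, window_add, window_add_period hx, ih, List.replicate_succ,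
      List.flatten_cons]

lemma eq_of_window_eq {x y : ℤ → A} {k : ℕ} (hk : 0 < k) (hx : Function.Periodic x (k : ℤ))
    (hy : Function.Periodic y (k : ℤ)) (h : window x 0 k = window y 0 k) : x = y := by
  funext i
  rw [← apply_emod hx, ← apply_emod hy]
  have h0 : 0 ≤ i % k := Int.emod_nonneg _ (by omega)
  have h1 : i % k < k := Int.emod_lt_of_pos _ (by omega)
  have := apply_eq_of_window_eq h (t := (i % k).toNat) (by omega)
  rwa [Int.toNat_of_nonneg h0, zero_add] at this

/-- The periodic sequence that repeats the word `w`. The letter `a` is only used if `w` is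
empty. -/
def periodize (a : A) (w : List A) : ℤ → A := fun i => w.getD (i % w.length).toNat a

lemma periodic_periodize (a : A) (w : List A) :
    Function.Periodic (periodize a w) (w.length : ℤ) := fun i => by
  simp [periodize]

lemma window_periodize (a : A) (w : List A) : window (periodize a w) 0 w.length = w := by
  refine List.ext_getElem (by simp) fun n h1 h2 => ?_
  have : ((n : ℤ) % w.length).toNat = n := by
    rw [Int.emod_eq_of_lt (by omega) (by omega)]; rfl
  simp [window, periodize, this, h2]

/-- One periodic sequence is a shift of the other, and reducing the shift modulo the length gives
the place to cut `w`. -/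
lemma exists_rotation {a : A} {w w' : List A} (hw : w ≠ []) (hlen : w.length = w'.length)
    (h : Function.periodicOrbit shift (periodize a w) =
      Function.periodicOrbit shift (periodize a w')) :
    ∃ X Y, w = X ++ Y ∧ w' = Y ++ X := by
  have hpos : 0 < w.length := List.length_pos_iff.2 hw
  have hx := periodic_periodize a w
  have hmem : ∀ v : List A, 0 < v.length → periodize a v ∈ Function.periodicPts shift :=
    fun v hv => ⟨_, hv, isPeriodicPt_shift_iff.2 (periodic_periodize a v)⟩
  have h1 := Function.self_mem_periodicOrbit (hmem w' (hlen ▸ hpos))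
  rw [← h, Function.mem_periodicOrbit_iff (hmem w hpos)] at h1
  obtain ⟨n, hn⟩ := h1
  set n' := n % w.length with hn'
  have hlt : n' < w.length := Nat.mod_lt _ hpos
  have hw' : w' = window (periodize a w) (n' : ℤ) w.length := by
    conv_lhs => rw [← window_periodize a w', ← hn, ← hlen, shift_iterate]
    rw [hn', Int.natCast_mod, window_emod hx]
    exact window_ext fun t _ => by congr 1; ring
  refine ⟨window (periodize a w) 0 n', window (periodize a w) n' (w.length - n'), ?_, ?_⟩
  · conv_lhs => rw [← window_periodize a w, ← Nat.add_sub_cancel' hlt.le, window_add]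
    rw [zero_add]
  · rw [hw']
    conv_lhs => rw [← Nat.sub_add_cancel hlt.le, window_add]
    congr 1
    rw [← window_add_period hx 0 n']
    congr 1
    omega

end Window

/-! ### Periodic orbits and ascents along closed paths -/

lemma mem_markovDyckShift_iff {x : ℤ → Letter E} :
    x ∈ G.markovDyckShift ↔ ∀ (i : ℤ) (n : ℕ), 0 < n → G.eval (window x i n) ≠ G.gen .zero := by
  simp only [markovDyckShift, eval, window, List.map_map]
  rfl

lemma hasNegMultiplier_iff {e : {e : E // e ∉ G.treeEdges}} {x : ℤ → Letter E} :
    G.HasNegMultiplier e x ↔ ∃ (i : ℤ) (m : ℕ), 0 < m ∧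
      G.evalHat (window x i (Function.minimalPeriod shift x)) = G.contraction.gen (.neg e) ^ m := by
  simp only [HasNegMultiplier, evalHat, window, List.map_map]
  rfl

lemma exists_idem_mul_ne_zero {a : Letter E} {w : List (Letter E)}
    (h : G.eval (a :: w) ≠ G.gen .zero) :
    ∃ v, G.gen (.idem v) * G.eval (a :: w) ≠ G.gen .zero := by
  cases a with
  | neg f =>
    refine ⟨G.src f, ?_⟩
    rwa [eval_cons, Letter.toGen, ← mul_assoc, idem_mul_neg]
  | pos f =>
    refine ⟨G.tgt f, ?_⟩
    rwa [eval_cons, Letter.toGen, ← mul_assoc, idem_mul_pos]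

lemma IsTreeWithRoot.run_neg_pow (hr : G.IsTreeWithRoot r) (e : {e : E // e ∉ G.treeEdges})
    (m : ℕ) : G.contraction.run (G.contraction.gen (.neg e) ^ m) (some (G.subtreeOf r, [])) =
      some (G.subtreeOf r, List.replicate m e) := by
  induction m with
  | zero => simp [run_one]
  | succ m ih => rw [pow_succ, run_mul, ih, hr.run_neg, List.replicate_succ]

/-- The given period may start in the middle of a Dyck word or pop tree edges. Rotating it to start
just after its last unmatched `e⁻` puts the start at the root and removes both defects. -/
lemma IsTreeWithRoot.exists_isAscent (hr : G.IsTreeWithRoot r) {e : {e : E // e ∉ G.treeEdges}}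
    {T : List E} (hT : G.IsPath G.treeEdges r (G.src e.1) T) {x : ℤ → Letter E} {k m : ℕ} {i : ℤ}
    (hx : x ∈ G.markovDyckShift) (hk : 0 < k) (hp : Function.Periodic x (k : ℤ)) (hm : 0 < m)
    (hw : G.evalHat (window x i k) = G.contraction.gen (.neg e) ^ m) :
    ∃ (j : ℤ) (m' : ℕ), 0 < m' ∧
      G.IsAscent r (List.replicate m' (T ++ [e.1])).flatten (window x j k) := by
  rw [mem_markovDyckShift_iff] at hx
  have hrun := hr.run_neg_pow e m
  rw [← hw] at hrun
  obtain ⟨v, hv⟩ : ∃ v, G.gen (.idem v) * G.eval (window x i k) ≠ G.gen .zero := by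
    have := hx i k hk
    obtain ⟨k, rfl⟩ := Nat.exists_eq_succ_of_ne_zero hk.ne'
    rw [Nat.succ_eq_add_one, window_succ] at this ⊢
    exact exists_idem_mul_ne_zero this
  obtain ⟨p, q, hn⟩ := exists_hasNormalForm hv
  obtain ⟨-, l, hl, hlq⟩ := hn.run_evalHat hr (by simp [hrun])
  rw [hrun, Option.some_inj, Prod.mk.injEq] at hl
  obtain ⟨-, rfl⟩ := hl
  obtain ⟨A, B, q', hAB, hB, hsub, hnot⟩ := hn.exists_split ((hlq e).1 (by simp [hm.ne']))
  have hlen : k = A.length + 1 + B.length := by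
    have := congrArg List.length hAB
    simp at this
    omega
  have hsplit : window x i (A.length + 1) = A ++ [.neg e.1] ∧
      window x (i + (A.length + 1 : ℕ)) B.length = B := by
    rw [hlen, window_add] at hAB
    exact List.append_inj (hAB.trans (by simp)) (by simp)
  set j := i + (A.length + 1 : ℕ) with hj
  have hw' : window x j k = B ++ (A ++ [.neg e.1]) := by
    conv_lhs => rw [hlen, add_comm, window_add]
    rw [hsplit.2, ← hsplit.1, ← window_add_period hp i]
    congr 2
    rw [hj, hlen]; push_cast; ring
  have hxj : x (j - 1) = .neg e.1 := by
    have := hsplit.1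
    rw [window_add] at this
    have := (List.append_inj' this (by simp)).2
    simp only [window, List.range_one, List.map_singleton, List.cons.injEq, and_true] at this
    rw [← this, hj]
    congr 1; push_cast; ring
  -- The letter before the new window is `e⁻`, whose target is the root.
  have hroot : G.gen (.idem r) * G.eval (window x j k) ≠ G.gen .zero := by
    have h1 := hx (j - 1) (k + 1) (by omega)
    rw [window_succ, hxj, sub_add_cancel, eval_cons, Letter.toGen, ← neg_mul_idem, hr.tgt_eq e.2,
      mul_assoc] at h1
    intro h0
    rw [h0, mul_gen_zero] at h1
    exact h1 rfl
  obtain ⟨p', q', hn'⟩ := exists_hasNormalForm hroot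
  -- The tail `B` stacks no edge: its pushes outside the tree could only be of `e`, and `e` was cut
  -- off. Moving it to the front therefore does not change the resulting stack.
  have hrun' : G.contraction.run (G.evalHat (window x j k)) (some (G.subtreeOf r, [])) =
      some (G.subtreeOf r, List.replicate m e) := by
    have hBid : ∀ l, G.contraction.run (G.evalHat B) (some (G.subtreeOf r, l)) =
        some (G.subtreeOf r, l) := by
      intro l
      obtain ⟨l', h1, h2⟩ := hB.run_evalHat_of_pushes hr rfl l
      obtain rfl : l' = [] := by
        refine List.eq_nil_iff_forall_not_mem.2 fun g hg => ?_
        have hg' := (h2 g).1 hg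
        have := (hlq g).2 (hsub hg')
        obtain rfl : g = e := List.eq_of_mem_replicate this
        exact hnot hg'
      simpa using h1
    rw [hw', evalHat_append, run_mul, hBid]
    rw [hAB, show A ++ Letter.neg e.1 :: B = (A ++ [.neg e.1]) ++ B by simp, evalHat_append,
      run_mul, evalHat_append, run_mul] at hrun
    rw [evalHat_append, run_mul]
    rcases hA : G.contraction.run (G.evalHat A) (some (G.subtreeOf r, [])) with _ | ⟨u, l⟩
    · rw [hA, run_none, run_none] at hrun; simp at hrun
    · rw [hA] at hrun
      obtain rfl : u = G.subtreeOf r := Quot.inductionOn u fun v => hr.subtreeOf_eq v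
      rw [evalHat_cons, evalHat_nil, mul_one, hat_neg_of_notMem e.2, hr.run_neg] at hrun ⊢
      rw [hBid] at hrun
      exact hrun
  obtain ⟨htree, l, hl, hlq'⟩ := hn'.run_evalHat hr (by simp [hrun'])
  rw [hrun', Option.some_inj, Prod.mk.injEq] at hl
  obtain ⟨-, rfl⟩ := hl
  -- Only tree edges could be popped, and no tree edge enters the root.
  have hp' : p' = [] := by
    generalize window x j k = w' at hn'
    cases hn' with
    | dyck _ => rfl
    | push _ _ _ => rfl
    | pop h1 _ _ => exact absurd h1 (hr.tgt_ne (htree _ (by simp)))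
  obtain ⟨hasc, q₀, hq₀⟩ := hn'.isAscent hp' (hw'.trans (List.append_assoc _ _ _).symm)
  obtain ⟨u, hu⟩ := hasc.exists_isPath
  obtain ⟨m', hm', h⟩ := hr.path_eq_flatten e.2 hT (t := []) rfl hu hq₀ fun f hf hft =>
    congrArg Subtype.val (List.eq_of_mem_replicate ((hlq' ⟨f, hft⟩).2 hf))
  exact ⟨j, m', hm', h ▸ hasc⟩

lemma IsTreeWithRoot.exists_isAscent_of_mem_orbits (hr : G.IsTreeWithRoot r)
    {e : {e : E // e ∉ G.treeEdges}} {T : List E} (hT : G.IsPath G.treeEdges r (G.src e.1) T)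
    {k : ℕ} {o : Cycle (ℤ → Letter E)} (ho : o ∈ G.orbitsWithMultiplier e k) :
    ∃ m w, 0 < m ∧ G.IsAscent r (List.replicate m (T ++ [e.1])).flatten w ∧ w.length = k ∧
      Function.periodicOrbit shift (periodize (.neg e.1) w) = o := by
  obtain ⟨x, hx, hper, rfl, hmul, rfl⟩ := ho
  obtain ⟨i, m, hm, hw⟩ := hasNegMultiplier_iff.1 hmul
  set k := Function.minimalPeriod shift x with hk
  have hk0 : 0 < k := Function.minimalPeriod_pos_of_mem_periodicPts hper
  have hp : Function.Periodic x (k : ℤ) :=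
    isPeriodicPt_shift_iff.1 (Function.isPeriodicPt_minimalPeriod shift x)
  obtain ⟨j, m', hm', hasc⟩ := hr.exists_isAscent hT hx hk0 hp hm hw
  refine ⟨m', _, hm', hasc, by simp, ?_⟩
  rw [← Function.periodicOrbit_apply_iterate_eq hper (j % k).toNat]
  congr 1
  have hlen : (window x j k).length = k := by simp
  have hp2 := periodic_periodize (Letter.neg e.1) (window x j k)
  rw [hlen] at hp2
  have hj : (((j % k).toNat : ℕ) : ℤ) = j % k := Int.toNat_of_nonneg (Int.emod_nonneg _ (by omega))
  rw [shift_iterate]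
  refine eq_of_window_eq hk0 hp2 (fun i => by rw [add_right_comm, hp]) ?_
  have h2 := window_periodize (Letter.neg e.1) (window x j k)
  rw [hlen] at h2
  rw [h2, ← window_emod hp j, ← hj]
  exact window_ext fun t _ => by simp [add_comm]

lemma IsAscent.flatten_replicate {c : List E} {w : List (Letter E)}
    (hc : G.IsPath Set.univ r r c) (hw : G.IsAscent r c w) (n : ℕ) :
    G.IsAscent r (List.replicate n c).flatten (List.replicate n w).flatten := by
  induction n with
  | zero => rfl
  | succ n ih =>
    simp only [List.replicate_succ, List.flatten_cons]
    exact hw.append hc ih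

lemma IsPath.flatten_replicate {S : Set E} {c : List E}
    (hc : G.IsPath S r r c) (n : ℕ) : G.IsPath S r r (List.replicate n c).flatten := by
  induction n with
  | zero => rfl
  | succ n ih =>
    simp only [List.replicate_succ, List.flatten_cons]
    exact hc.append ih

lemma weight_flatten_replicate (φ : E → ℕ) (w : List (Letter E)) (n : ℕ) :
    weight φ (List.replicate n w).flatten = n * weight φ w := by
  induction n with
  | zero => simp
  | succ n ih =>
    rw [List.replicate_succ, List.flatten_cons, weight_append, ih]; push_cast; ring

/-- Along a closed path the powers of `w` are again ascents, hence nonzero, and every window of the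
periodic sequence is a factor of such a power. -/
lemma IsAscent.periodize_mem_markovDyckShift {c : List E} {w : List (Letter E)} {a : Letter E}
    (hc : G.IsPath Set.univ r r c) (hw : G.IsAscent r c w) (hw0 : w ≠ []) :
    periodize a w ∈ G.markovDyckShift := by
  have hpos : 0 < w.length := List.length_pos_iff.2 hw0
  have hx := periodic_periodize a w
  rw [mem_markovDyckShift_iff]
  intro i n _
  rw [← window_emod hx]
  obtain ⟨s, hs⟩ := Int.eq_ofNat_of_zero_le (Int.emod_nonneg i (b := w.length) (by omega))
  rw [hs]
  have hle : s + n ≤ w.length * (s + n) := Nat.le_mul_of_pos_left _ hpos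
  obtain ⟨t, ht⟩ := Nat.exists_eq_add_of_le hle
  have h1 := (hw.flatten_replicate hc (s + n)).run_eval_ne_none []
  have h2 := window_mul hx 0 (s + n)
  rw [window_periodize, ht, window_add, window_add, zero_add] at h2
  rw [← h2] at h1
  exact eval_ne_zero_of_append (ne_zero_of_run h1)

section
variable [DecidableEq E]

lemma sum_map_single_tree {S : Set E} {e : E} (he : e ∉ S) {T : List E} (hT : ∀ f ∈ T, f ∈ S) :
    (T.map (Pi.single e (1 : ℕ))).sum = 0 := by
  rw [List.sum_eq_zero]
  intro x hx
  obtain ⟨f, hf, rfl⟩ := List.mem_map.1 hx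
  exact Pi.single_eq_of_ne (by rintro rfl; exact he (hT _ hf)) _

lemma sum_map_single_flatten {S : Set E} {e : E} (he : e ∉ S) {T : List E}
    (hT : ∀ f ∈ T, f ∈ S) (m : ℕ) :
    ((List.replicate m (T ++ [e])).flatten.map (Pi.single e (1 : ℕ))).sum = m := by
  induction m with
  | zero => rfl
  | succ m ih =>
    rw [List.replicate_succ, List.flatten_cons, List.map_append, List.sum_append, ih,
      List.map_append, List.sum_append, sum_map_single_tree he hT]
    simp [add_comm]

end

/-- Coprimality makes `w` primitive: if `w` is a `t`-th power, then `t` divides its length and also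
`m`, its weight when only `e` counts. -/
lemma IsTreeWithRoot.periodicOrbit_mem_orbits (hr : G.IsTreeWithRoot r)
    {e : {e : E // e ∉ G.treeEdges}} {T : List E} (hT : G.IsPath G.treeEdges r (G.src e.1) T)
    {m : ℕ} (hm : 0 < m) {w : List (Letter E)} (hco : m.Coprime w.length)
    (hw : G.IsAscent r (List.replicate m (T ++ [e.1])).flatten w) :
    Function.periodicOrbit shift (periodize (.neg e.1) w) ∈ G.orbitsWithMultiplier e w.length := by
  classical
  set c := (List.replicate m (T ++ [e.1])).flatten with hc
  have hpath : G.IsPath Set.univ r r c := by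
    refine IsPath.flatten_replicate ((hT.mono (Set.subset_univ _)).append ?_) m
    exact ⟨trivial, rfl, hr.tgt_eq e.2⟩
  have hwt : weight (Pi.single e.1 1) w = m := by
    rw [hw.weight_eq, hc, sum_map_single_flatten e.2 hT.mem]
  have hw0 : w ≠ [] := by
    rintro rfl
    simp at hwt
    omega
  have hpos : 0 < w.length := List.length_pos_iff.2 hw0
  set x := periodize (.neg e.1) w with hx
  have hper := isPeriodicPt_shift_iff.2 (periodic_periodize (.neg e.1) w)
  rw [← hx] at hper
  have hmin : Function.minimalPeriod shift x = w.length := by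
    obtain ⟨t, ht⟩ := hper.minimalPeriod_dvd
    set d := Function.minimalPeriod shift x
    have hd : Function.Periodic x (d : ℤ) :=
      isPeriodicPt_shift_iff.1 (Function.isPeriodicPt_minimalPeriod shift x)
    have h1 := window_mul hd 0 t
    rw [← ht, hx, window_periodize] at h1
    rw [h1, weight_flatten_replicate] at hwt
    have h2 : t ∣ m := Int.natCast_dvd_natCast.1 ⟨_, hwt.symm⟩
    have h3 : t ∣ w.length := ⟨d, by rw [ht, mul_comm]⟩
    have h4 : t = 1 := Nat.dvd_one.1 (hco ▸ Nat.dvd_gcd h2 h3)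
    rw [ht, h4, mul_one]
  refine ⟨x, hw.periodize_mem_markovDyckShift hpath hw0, ⟨_, hpos, hper⟩, hmin, ?_, rfl⟩
  rw [hasNegMultiplier_iff]
  refine ⟨0, m, hm, ?_⟩
  rw [hmin, hx, window_periodize]
  exact hw.evalHat_eq hr e hT.mem hm

lemma IsAscent.ends_neg {q : List E} {e : E} : ∀ {v : V} {w : List (Letter E)},
    G.IsAscent v (q ++ [e]) w → ∃ w₀, w = w₀ ++ [.neg e] := by
  induction q with
  | nil => rintro v w ⟨hf, A, B, hA, rfl, rfl⟩; exact ⟨A, rfl⟩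
  | cons f q ih =>
    rintro v w ⟨hf, A, B, hA, hB, rfl⟩
    obtain ⟨w₀, rfl⟩ := ih hB
    exact ⟨A ++ .neg f :: w₀, by simp⟩

/-- Two ascents along the same path that passes through its last edge only once do not differ by
a cyclic rotation. -/
lemma IsAscent.eq_of_rotation {T : List E} {e : E} (he : e ∉ T) {v : V}
    {X Y : List (Letter E)} (h : G.IsAscent v (T ++ [e]) (X ++ Y))
    (h' : G.IsAscent v (T ++ [e]) (Y ++ X)) : X ++ Y = Y ++ X := by
  classical
  -- A nonempty `X` ends in `e⁻`, as a suffix of an ascent, and what precedes that letter has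
  -- nonnegative weight, as a prefix of one. Two nonempty parts would give total weight at least
  -- two, but `e` occurs only once in the path.
  have key : ∀ {X Y : List (Letter E)}, G.IsAscent v (T ++ [e]) (X ++ Y) →
      G.IsAscent v (T ++ [e]) (Y ++ X) → X ≠ [] → 1 ≤ weight (Pi.single e 1) X := by
    intro X Y h h' hX
    obtain ⟨X₀, a, rfl⟩ := (List.eq_nil_or_concat X).resolve_left hX
    obtain ⟨w₀, hw₀⟩ := h'.ends_neg
    rw [List.concat_eq_append, ← List.append_assoc] at hw₀
    obtain rfl : a = .neg e := by simpa using (List.append_inj' hw₀ rfl).2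
    have := h.weight_prefix_nonneg (Pi.single e 1) (X := X₀) ⟨[.neg e] ++ Y, by simp⟩
    simpa using this
  by_cases hX : X = []
  · simp [hX]
  by_cases hY : Y = []
  · simp [hY]
  have h1 := key h h' hX
  have h2 := key h' h hY
  have h3 := h.weight_eq (Pi.single e 1)
  rw [List.map_append, List.sum_append,
    sum_map_single_tree (S := {f | f ∈ T}) he (fun f hf => hf), weight_append] at h3
  simp at h3
  omega

/-! ### Counting Dyck words and ascents -/

instance [Finite E] : Finite (Letter E) :=
  Finite.of_surjective (fun s : E ⊕ E => s.elim Letter.neg Letter.pos) fun a => by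
    cases a with
    | neg e => exact ⟨.inl e, rfl⟩
    | pos e => exact ⟨.inr e, rfl⟩

/-- The number of Dyck words of length `2 * n` at the vertex `v`. -/
noncomputable def dyckCount (G : DirectedMultigraph V E) (v : V) (n : ℕ) : ℕ :=
  {w | G.IsDyck v w ∧ w.length = 2 * n}.ncard

/-- The number of ascents of length `k` along the path `q` that starts at `v`. -/
noncomputable def ascentCount (G : DirectedMultigraph V E) (v : V) (q : List E) (k : ℕ) : ℕ :=
  {w | G.IsAscent v q w ∧ w.length = k}.ncard

lemma finite_words [Finite E] (P : List (Letter E) → Prop) (k : ℕ) :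
    {w | P w ∧ w.length = k}.Finite :=
  (List.finite_length_eq (Letter E) k).subset fun _ h => h.2

/-- Unique decomposition at the marked letter turns a count into a convolution; this serves both
Dyck words and ascents. -/
lemma ncard_append_cons {α : Type*} (x : α) (n : ℕ) {S T : ℕ → Set (List α)}
    (hS : ∀ i, (S i).Finite) (hT : ∀ i, (T i).Finite)
    (hlen : ∀ i, ∀ A ∈ S i, A.length = 2 * i)
    (huniq : ∀ i i' j j', ∀ A ∈ S i, ∀ A' ∈ S i', ∀ B ∈ T j, ∀ B' ∈ T j',
      A ++ x :: B = A' ++ x :: B' → A = A') :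
    {w | ∃ p ∈ Finset.HasAntidiagonal.antidiagonal n, ∃ A ∈ S p.1, ∃ B ∈ T p.2, w = A ++ x :: B}.ncard =
      ∑ p ∈ Finset.HasAntidiagonal.antidiagonal n, (S p.1).ncard * (T p.2).ncard := by
  classical
  have hset : {w | ∃ p ∈ Finset.HasAntidiagonal.antidiagonal n, ∃ A ∈ S p.1, ∃ B ∈ T p.2, w = A ++ x :: B} =
      (((Finset.HasAntidiagonal.antidiagonal n).sigma fun p => (hS p.1).toFinset ×ˢ (hT p.2).toFinset).image
        fun s => s.2.1 ++ x :: s.2.2 : Finset (List α)) := by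
    ext w
    simp only [Set.mem_ofPred_eq, Finset.coe_image, Set.mem_image, Finset.mem_coe, Finset.mem_sigma,
      Finset.mem_product, Set.Finite.mem_toFinset]
    constructor
    · rintro ⟨p, hp, A, hA, B, hB, rfl⟩
      exact ⟨⟨p, A, B⟩, ⟨hp, hA, hB⟩, rfl⟩
    · rintro ⟨⟨p, A, B⟩, ⟨hp, hA, hB⟩, rfl⟩
      exact ⟨p, hp, A, hA, B, hB, rfl⟩
  rw [hset, Set.ncard_coe_finset, Finset.card_image_of_injOn, Finset.card_sigma]
  · refine Finset.sum_congr rfl fun p _ => ?_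
    rw [Finset.card_product, Set.ncard_eq_toFinset_card _ (hS p.1),
      Set.ncard_eq_toFinset_card _ (hT p.2)]
  · rintro ⟨⟨i, j⟩, A, B⟩ h ⟨⟨i', j'⟩, A', B'⟩ h' heq
    simp only [Finset.mem_coe, Finset.mem_sigma, Finset.mem_product, Set.Finite.mem_toFinset,
      Finset.HasAntidiagonal.mem_antidiagonal] at h h' heq
    obtain rfl := huniq _ _ _ _ A h.2.1 A' h'.2.1 B h.2.2 B' h'.2.2 heq
    have h1 := hlen _ _ h.2.1
    have h2 := hlen _ _ h'.2.1
    obtain rfl : i = i' := by omega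
    obtain rfl : j = j' := by omega
    simp at heq
    rw [heq]

/-- The displayed pop is where the height first becomes negative. -/
lemma IsDyck.append_pos_cons_inj {v v' : V} {A A' B B' : List (Letter E)} {f f' : E}
    (hA : G.IsDyck v A) (hA' : G.IsDyck v' A') (h : A ++ .pos f :: B = A' ++ .pos f' :: B') :
    A = A' := by
  have key : ∀ {v : V} {A' Z : List (Letter E)} {v' : V} {A : List (Letter E)} {f : E}
      {Y : List (Letter E)}, G.IsDyck v A → G.IsDyck v' A' → A' = A ++ Z →
      .pos f :: B = Z ++ Y → A = A' := by
    rintro v A' Z v' A f Y hA hA' rfl hZ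
    rcases Z with _ | ⟨z, Z⟩
    · simp
    · simp only [List.cons_append, List.cons.injEq] at hZ
      obtain ⟨rfl, -⟩ := hZ
      have := hA'.weight_prefix_nonneg (fun _ => 1) (X := A ++ [.pos f]) ⟨Z, by simp⟩
      simp [hA.weight_eq] at this
  rcases List.append_eq_append_iff.1 h with ⟨Z, h1, h2⟩ | ⟨Z, h1, h2⟩
  · exact key hA hA' h1 h2
  · rcases Z with _ | ⟨z, Z⟩
    · simpa using h1
    · simp only [List.cons_append, List.cons.injEq] at h2
      obtain ⟨rfl, -⟩ := h2
      have := hA.weight_prefix_nonneg (fun _ => 1) (X := A' ++ [.pos f']) ⟨Z, by simp [h1]⟩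
      simp [hA'.weight_eq] at this

/-- The displayed push is where the height leaves zero for the last time. If one Dyck word reached
beyond it, its total weight would be positive. -/
lemma IsAscent.append_neg_cons_inj {v v' u u' : V} {A A' B B' : List (Letter E)} {f : E}
    {q q' : List E} (hA : G.IsDyck v A) (hA' : G.IsDyck v' A') (hB : G.IsAscent u q B)
    (hB' : G.IsAscent u' q' B') (h : A ++ .neg f :: B = A' ++ .neg f :: B') : A = A' := by
  have key : ∀ {v v' u : V} {A A' B Z Y : List (Letter E)} {q : List E}, G.IsDyck v A →
      G.IsDyck v' A' → G.IsAscent u q B → A' = A ++ Z → .neg f :: B = Z ++ Y → A = A' := by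
    rintro v v' u A A' B Z Y q hA hA' hB rfl hZ
    rcases Z with _ | ⟨z, Z⟩
    · simp
    · simp only [List.cons_append, List.cons.injEq] at hZ
      obtain ⟨rfl, rfl⟩ := hZ
      have h1 := hA'.weight_eq (fun _ => 1)
      have h2 := hB.weight_prefix_nonneg (fun _ => 1) (X := Z) ⟨Y, rfl⟩
      simp [hA.weight_eq] at h1
      omega
  rcases List.append_eq_append_iff.1 h with ⟨Z, h1, h2⟩ | ⟨Z, h1, h2⟩
  · exact key hA hA' hB h1 h2
  · exact (key hA' hA hB' h1 h2).symm

lemma IsDyck.exists_length {v : V} {A : List (Letter E)} (hA : G.IsDyck v A) :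
    ∃ n, A.length = 2 * n := by
  induction hA with
  | nil => exact ⟨0, rfl⟩
  | cons f _ _ _ ih1 ih2 =>
    obtain ⟨i, hi⟩ := ih1
    obtain ⟨j, hj⟩ := ih2
    exact ⟨i + j + 1, by simp [hi, hj]; ring⟩

lemma IsAscent.exists_length {q : List E} : ∀ {v : V} {w : List (Letter E)},
    G.IsAscent v q w → ∃ n, w.length = q.length + 2 * n := by
  induction q with
  | nil => rintro v w rfl; exact ⟨0, rfl⟩
  | cons f q ih =>
    rintro v w ⟨hf, A, B, hA, hB, rfl⟩
    obtain ⟨i, hi⟩ := hA.exists_length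
    obtain ⟨j, hj⟩ := ih hB
    exact ⟨i + j, by simp [hi, hj]; ring⟩

lemma dyckCount_zero (v : V) : G.dyckCount v 0 = 1 := by
  rw [dyckCount, Set.ncard_eq_one]
  refine ⟨[], Set.eq_singleton_iff_unique_mem.2 ⟨⟨.nil v, rfl⟩, fun w hw => ?_⟩⟩
  simpa using hw.2

/-- First-return decomposition: a nonempty Dyck word begins with the push of some `f`, and the
matching pop of `f` separates a Dyck word at the target of `f` from one at `v`. -/
lemma dyckCount_succ [Fintype E] [DecidableEq V] (v : V) (n : ℕ) :
    G.dyckCount v (n + 1) = ∑ f : E with G.src f = v, ∑ p ∈ Finset.HasAntidiagonal.antidiagonal n,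
      G.dyckCount (G.tgt f) p.1 * G.dyckCount v p.2 := by
  classical
  let S : E → Set (List (Letter E)) := fun f => {w | ∃ p ∈ Finset.HasAntidiagonal.antidiagonal n,
    ∃ A ∈ {A | G.IsDyck (G.tgt f) A ∧ A.length = 2 * p.1},
      ∃ B ∈ {B | G.IsDyck v B ∧ B.length = 2 * p.2}, w = A ++ .pos f :: B}
  have hS : ∀ f, (S f).Finite := by
    intro f
    refine (finite_words (fun _ => True) (2 * n + 1)).subset ?_
    rintro w ⟨p, hp, A, hA, B, hB, rfl⟩
    rw [Finset.HasAntidiagonal.mem_antidiagonal] at hp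
    have h1 := hA.2
    have h2 := hB.2
    simp only [true_and, Set.mem_ofPred_eq, List.length_append, List.length_cons]
    omega
  have hset : {w | G.IsDyck v w ∧ w.length = 2 * (n + 1)} =
      (((Finset.univ.filter fun f => G.src f = v).sigma fun f => (hS f).toFinset).image
        fun s => .neg s.1 :: s.2 : Finset (List (Letter E))) := by
    ext w
    simp only [Set.mem_ofPred_eq, Finset.coe_image, Set.mem_image, Finset.mem_coe, Finset.mem_sigma,
      Set.Finite.mem_toFinset, Finset.mem_filter, Finset.mem_univ, true_and]
    constructor
    · rintro ⟨hw, hlen⟩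
      cases hw with
      | nil => simp at hlen
      | @cons _ f A B hf hA hB =>
        obtain ⟨i, hi⟩ := hA.exists_length
        obtain ⟨j, hj⟩ := hB.exists_length
        simp only [List.length_cons, List.length_append] at hlen
        exact ⟨⟨f, _⟩, ⟨hf, (i, j), Finset.HasAntidiagonal.mem_antidiagonal.2 (by omega), A, ⟨hA, hi⟩, B,
          ⟨hB, hj⟩, rfl⟩, rfl⟩
    · rintro ⟨⟨f, w⟩, ⟨hf, p, hp, A, hA, B, hB, h⟩, rfl⟩
      dsimp only at h hf ⊢
      subst h
      refine ⟨.cons f hf hA.1 hB.1, ?_⟩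
      rw [Finset.HasAntidiagonal.mem_antidiagonal] at hp
      have h1 := hA.2
      have h2 := hB.2
      simp only [List.length_append, List.length_cons]
      omega
  rw [dyckCount, hset, Set.ncard_coe_finset, Finset.card_image_of_injOn, Finset.card_sigma]
  · refine Finset.sum_congr rfl fun f _ => ?_
    rw [← Set.ncard_eq_toFinset_card _ (hS f)]
    refine ncard_append_cons (.pos f) n (S := fun i => {A | G.IsDyck (G.tgt f) A ∧ A.length = 2 * i})
      (T := fun i => {A | G.IsDyck v A ∧ A.length = 2 * i}) (fun i => finite_words _ _)
      (fun i => finite_words _ _) (fun i A hA => hA.2) ?_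
    intro i i' j j' A hA A' hA' B _ B' _ h
    exact hA.1.append_pos_cons_inj hA'.1 h
  · rintro ⟨f, w⟩ - ⟨f', w'⟩ - h
    simp only [List.cons.injEq, Letter.neg.injEq] at h
    obtain ⟨rfl, rfl⟩ := h
    rfl

lemma dyckCount_one [Finite E] (v : V) : G.dyckCount v 1 = G.outDegree v := by
  classical
  have := Fintype.ofFinite E
  rw [dyckCount_succ, outDegree]
  simp [dyckCount_zero, Set.ncard_eq_toFinset_card']

lemma ascentCount_nil (v : V) (k : ℕ) : G.ascentCount v [] k = if k = 0 then 1 else 0 := by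
  rw [ascentCount]
  split_ifs with hk
  · subst hk
    rw [Set.ncard_eq_one]
    exact ⟨[], Set.eq_singleton_iff_unique_mem.2 ⟨⟨rfl, rfl⟩, fun w hw => hw.1⟩⟩
  · have : {w : List (Letter E) | G.IsAscent v [] w ∧ w.length = k} = ∅ := by
      refine Set.eq_empty_iff_forall_notMem.2 ?_
      rintro w ⟨rfl, h⟩
      exact hk h.symm
    rw [this, Set.ncard_empty]

lemma ascentCount_cons [Finite E] (f : E) (q : List E) (n : ℕ) :
    G.ascentCount (G.src f) (f :: q) (q.length + 1 + 2 * n) = ∑ p ∈ Finset.HasAntidiagonal.antidiagonal n,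
      G.dyckCount (G.src f) p.1 * G.ascentCount (G.tgt f) q (q.length + 2 * p.2) := by
  refine Eq.trans ?_ (ncard_append_cons (.neg f) n
    (S := fun i => {A | G.IsDyck (G.src f) A ∧ A.length = 2 * i})
    (T := fun i => {A | G.IsAscent (G.tgt f) q A ∧ A.length = q.length + 2 * i})
    (fun i => finite_words _ _) (fun i => finite_words _ _) (fun i A hA => hA.2)
    fun i i' j j' A hA A' hA' B hB B' hB' h => IsAscent.append_neg_cons_inj hA.1 hA'.1 hB.1 hB'.1 h)
  rw [ascentCount]
  congr 1
  ext w
  constructor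
  · rintro ⟨⟨-, A, B, hA, hB, rfl⟩, hlen⟩
    obtain ⟨i, hi⟩ := hA.exists_length
    obtain ⟨j, hj⟩ := hB.exists_length
    simp only [List.length_cons, List.length_append] at hlen
    exact ⟨(i, j), Finset.HasAntidiagonal.mem_antidiagonal.2 (by omega), A, ⟨hA, hi⟩, B, ⟨hB, hj⟩, rfl⟩
  · rintro ⟨p, hp, A, hA, B, hB, rfl⟩
    rw [Finset.HasAntidiagonal.mem_antidiagonal] at hp
    have h1 := hA.2
    have h2 := hB.2
    refine ⟨⟨rfl, A, B, hA.1, hB.1, rfl⟩, ?_⟩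
    simp only [List.length_append, List.length_cons]
    omega

lemma ascentCount_eq_zero {v : V} {q : List E} {k : ℕ} (h : ∀ n, k ≠ q.length + 2 * n) :
    G.ascentCount v q k = 0 := by
  have : {w : List (Letter E) | G.IsAscent v q w ∧ w.length = k} = ∅ := by
    refine Set.eq_empty_iff_forall_notMem.2 ?_
    rintro w ⟨hw, hlen⟩
    obtain ⟨n, hn⟩ := hw.exists_length
    exact h n (hlen.symm.trans hn)
  rw [ascentCount, this, Set.ncard_empty]

/-! ### Bounds for the numbers of orbits -/

lemma IsTreeWithRoot.orbits_subset (hr : G.IsTreeWithRoot r) {e : {e : E // e ∉ G.treeEdges}}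
    {T : List E} (hT : G.IsPath G.treeEdges r (G.src e.1) T) (k : ℕ) :
    G.orbitsWithMultiplier e k ⊆
      (fun w => Function.periodicOrbit shift (periodize (.neg e.1) w)) ''
        ⋃ m ∈ Finset.Icc 1 k,
          {w | G.IsAscent r (List.replicate m (T ++ [e.1])).flatten w ∧ w.length = k} := by
  intro o ho
  obtain ⟨m, w, hm, hw, hlen, rfl⟩ := hr.exists_isAscent_of_mem_orbits hT ho
  refine ⟨w, Set.mem_biUnion (x := m) ?_ ⟨hw, hlen⟩, rfl⟩
  obtain ⟨n, hn⟩ := hw.exists_length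
  have : m ≤ (List.replicate m (T ++ [e.1])).flatten.length := by
    simp only [List.length_flatten, List.map_replicate, List.sum_replicate, smul_eq_mul,
      List.length_append, List.length_singleton]
    exact Nat.le_mul_of_pos_right _ (by omega)
  simp only [Finset.coe_Icc, Set.mem_Icc]
  omega

lemma IsTreeWithRoot.orbits_finite [Finite E] (hr : G.IsTreeWithRoot r)
    (e : {e : E // e ∉ G.treeEdges}) (k : ℕ) : (G.orbitsWithMultiplier e k).Finite := by
  obtain ⟨T, hT, -⟩ := hr (G.src e.1)
  refine (Set.Finite.image _ ?_).subset (hr.orbits_subset hT k)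
  exact Set.Finite.biUnion (Finset.finite_toSet _) fun m _ => finite_words _ _

/-- This may overcount, by rotations and by imprimitive words, but the excess is harmless in the
comparisons below. -/
lemma IsTreeWithRoot.orbitCount_le [Finite E] (hr : G.IsTreeWithRoot r)
    {e : {e : E // e ∉ G.treeEdges}} {T : List E} (hT : G.IsPath G.treeEdges r (G.src e.1) T)
    (k : ℕ) : G.orbitCount e k ≤
      ∑ m ∈ Finset.Icc 1 k, G.ascentCount r (List.replicate m (T ++ [e.1])).flatten k := by
  have hfin : (⋃ m ∈ Finset.Icc 1 k, {w | G.IsAscent r (List.replicate m (T ++ [e.1])).flatten w ∧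
      w.length = k}).Finite :=
    Set.Finite.biUnion (Finset.finite_toSet _) fun m _ => finite_words _ _
  calc G.orbitCount e k ≤ _ := Set.ncard_le_ncard (hr.orbits_subset hT k) (hfin.image _)
    _ ≤ _ := Set.ncard_image_le hfin
    _ ≤ _ := Finset.set_ncard_biUnion_le _ _

lemma injOn_periodicOrbit {e : {e : E // e ∉ G.treeEdges}}
    {T : List E} (hT : G.IsPath G.treeEdges r (G.src e.1) T) (k : ℕ) :
    Set.InjOn (fun w => Function.periodicOrbit shift (periodize (.neg e.1) w))
      {w | G.IsAscent r (T ++ [e.1]) w ∧ w.length = k} := by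
  rintro w ⟨hw, hlen⟩ w' ⟨hw', hlen'⟩ h
  have hw0 : w ≠ [] := by
    obtain ⟨w₀, rfl⟩ := hw.ends_neg
    simp
  obtain ⟨X, Y, rfl, rfl⟩ := exists_rotation hw0 (hlen.trans hlen'.symm) h
  exact hw.eq_of_rotation (fun he => e.2 (hT.mem _ he)) hw'

lemma IsTreeWithRoot.periodicOrbit_mem_orbits_of_isAscent (hr : G.IsTreeWithRoot r)
    {e : {e : E // e ∉ G.treeEdges}} {T : List E} (hT : G.IsPath G.treeEdges r (G.src e.1) T)
    {w : List (Letter E)} (hw : G.IsAscent r (T ++ [e.1]) w) :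
    Function.periodicOrbit shift (periodize (.neg e.1) w) ∈ G.orbitsWithMultiplier e w.length :=
  hr.periodicOrbit_mem_orbits hT one_pos (Nat.coprime_one_left _) (by simpa using hw)

lemma IsTreeWithRoot.ascentCount_le_orbitCount [Finite E] (hr : G.IsTreeWithRoot r)
    {e : {e : E // e ∉ G.treeEdges}} {T : List E} (hT : G.IsPath G.treeEdges r (G.src e.1) T)
    (k : ℕ) : G.ascentCount r (T ++ [e.1]) k ≤ G.orbitCount e k := by
  rw [ascentCount, ← (injOn_periodicOrbit hT k).ncard_image]
  refine Set.ncard_le_ncard ?_ (hr.orbits_finite e k)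
  rintro _ ⟨w, ⟨hw, rfl⟩, rfl⟩
  exact hr.periodicOrbit_mem_orbits_of_isAscent hT hw

/-- If the edge `e` is a loop at the root, then there are also the orbits with three unmatched
letters `e⁻` per period. -/
lemma IsTreeWithRoot.ascentCount_add_outDegree_le_orbitCount [Finite E] (hr : G.IsTreeWithRoot r)
    {e : {e : E // e ∉ G.treeEdges}} (he : G.src e.1 = r) :
    G.ascentCount r [e.1] 5 + G.outDegree r ≤ G.orbitCount e 5 := by
  classical
  have hT : G.IsPath G.treeEdges r (G.src e.1) [] := he.symm
  -- One Dyck word of length two followed by three unmatched `e⁻`: length five, and coprime to the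
  -- multiplicity three.
  let ψ : E → List (Letter E) := fun f => [.neg f, .pos f, .neg e.1, .neg e.1, .neg e.1]
  let Φ : List (Letter E) → Cycle (ℤ → Letter E) :=
    fun w => Function.periodicOrbit shift (periodize (.neg e.1) w)
  set S₁ := {w | G.IsAscent r [e.1] w ∧ w.length = 5} with hS₁
  set S₃ := ψ '' {f | G.src f = r} with hS₃
  have hψ : ∀ f, G.src f = r → G.IsAscent r [e.1, e.1, e.1] (ψ f) := by
    intro f hf
    have htgt : G.src e.1 = G.tgt e.1 := by rw [he, hr.tgt_eq e.2]
    exact ⟨he, [.neg f, .pos f], _, .cons (A := []) f hf (.nil _) (.nil _),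
      ⟨htgt, [], _, .nil _, ⟨htgt, [], _, .nil _, rfl, rfl⟩, rfl⟩, rfl⟩
  have hwt₁ : ∀ w ∈ S₁, weight (fun _ => 1) w = 1 := fun w hw => by simp [hw.1.weight_eq]
  have hwt₃ : ∀ w ∈ S₃, weight (fun _ => 1) w = 3 := by
    rintro _ ⟨f, hf, rfl⟩
    simp [(hψ f hf).weight_eq]
  have hlen : ∀ w ∈ S₁ ∪ S₃, w.length = 5 := by
    rintro w (hw | ⟨f, hf, rfl⟩)
    · exact hw.2
    · rfl
  have hdisj : Disjoint S₁ S₃ := Set.disjoint_left.2 fun w h1 h3 => by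
    have := hwt₁ w h1
    rw [hwt₃ w h3] at this
    norm_num at this
  have hrot : ∀ w ∈ S₁ ∪ S₃, ∀ w' ∈ S₁ ∪ S₃, Φ w = Φ w' → ∃ X Y, w = X ++ Y ∧ w' = Y ++ X := by
    intro w hw w' hw' h
    refine exists_rotation (fun h0 => ?_) ((hlen w hw).trans (hlen w' hw').symm) h
    have := hlen w hw
    simp [h0] at this
  have hinj : Set.InjOn Φ (S₁ ∪ S₃) := by
    intro w hw w' hw' h
    obtain ⟨X, Y, hX, hY⟩ := hrot w hw w' hw' h
    -- The unit weight is invariant under rotation and separates the two families, with values one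
    -- and three.
    have hwt : weight (fun _ => 1) w = weight (fun _ => 1) w' := by simp [hX, hY, add_comm]
    rcases hw with hw | hw <;> rcases hw' with hw' | hw'
    · exact injOn_periodicOrbit (T := []) hT 5 hw hw' h
    · rw [hwt₁ w hw, hwt₃ w' hw'] at hwt; norm_num at hwt
    · rw [hwt₃ w hw, hwt₁ w' hw'] at hwt; norm_num at hwt
    · obtain ⟨f, hf, rfl⟩ := hw
      obtain ⟨f', hf', rfl⟩ := hw'
      -- The only pop in the word reveals `f` and survives rotation.
      have hmem : Letter.pos f ∈ ψ f' := by
        have : Letter.pos f ∈ ψ f := by simp [ψ]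
        rw [hX] at this
        rw [hY]
        simpa [or_comm] using this
      have : f = f' := by simpa [ψ] using hmem
      rw [this]
  have hfin : ∀ w ∈ S₁ ∪ S₃, Φ w ∈ G.orbitsWithMultiplier e 5 := by
    intro w hw
    rw [← hlen w hw]
    rcases hw with hw | ⟨f, hf, rfl⟩
    · exact hr.periodicOrbit_mem_orbits_of_isAscent hT hw.1
    · exact hr.periodicOrbit_mem_orbits hT (m := 3) (by norm_num) (by norm_num [ψ]) (hψ f hf)
  calc _ = S₁.ncard + S₃.ncard := by
        rw [hS₃, Set.ncard_image_of_injective _ (fun f f' h => by simpa [ψ] using h)]; rfl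
    _ = (S₁ ∪ S₃).ncard := (Set.ncard_union_eq hdisj (finite_words _ _) (Set.toFinite _)).symm
    _ = (Φ '' (S₁ ∪ S₃)).ncard := hinj.ncard_image.symm
    _ ≤ _ := Set.ncard_le_ncard (by rintro _ ⟨w, hw, rfl⟩; exact hfin w hw) (hr.orbits_finite e 5)

/-! ### Values of the counting functions -/

lemma dyckCount_succ_of_forall_eq [Finite E] {v : V} {X : ℕ → ℕ}
    (h : ∀ f, G.src f = v → ∀ i, G.dyckCount (G.tgt f) i = X i) (n : ℕ) :
    G.dyckCount v (n + 1) = G.outDegree v *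
      ∑ p ∈ Finset.HasAntidiagonal.antidiagonal n, X p.1 * G.dyckCount v p.2 := by
  classical
  have := Fintype.ofFinite E
  rw [dyckCount_succ, Finset.sum_congr rfl
    (g := fun _ => ∑ p ∈ Finset.HasAntidiagonal.antidiagonal n, X p.1 * G.dyckCount v p.2),
    Finset.sum_const, smul_eq_mul]
  · congr 1
    simp [outDegree, Set.ncard_eq_toFinset_card']
  · intro f hf
    simp only [h f (Finset.mem_filter.1 hf).2]

lemma dyckCount_eq_of_outDegree_eq [Finite E] {v v' : V} {X : ℕ → ℕ}
    (h : ∀ f, G.src f = v → ∀ i, G.dyckCount (G.tgt f) i = X i)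
    (h' : ∀ f, G.src f = v' → ∀ i, G.dyckCount (G.tgt f) i = X i)
    (hd : G.outDegree v = G.outDegree v') (n : ℕ) : G.dyckCount v n = G.dyckCount v' n := by
  induction n using Nat.strong_induction_on with
  | _ n ih =>
    rcases n with _ | n
    · simp only [dyckCount_zero]
    · rw [dyckCount_succ_of_forall_eq h, dyckCount_succ_of_forall_eq h', hd]
      congr 1
      refine Finset.sum_congr rfl fun p hp => ?_
      rw [Finset.HasAntidiagonal.mem_antidiagonal] at hp
      rw [ih p.2 (by omega)]

lemma ascentCount_singleton [Finite E] (f : E) (n : ℕ) :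
    G.ascentCount (G.src f) [f] (1 + 2 * n) = G.dyckCount (G.src f) n := by
  have := ascentCount_cons (G := G) f [] n
  simp only [List.length_nil, zero_add, ascentCount_nil] at this
  rw [this, Finset.sum_eq_single (n, 0)]
  · simp
  · rintro ⟨i, j⟩ hp hne
    rw [Finset.HasAntidiagonal.mem_antidiagonal] at hp
    have : j ≠ 0 := by rintro rfl; simp_all
    simp [this]
  · simp

/-- Without surplus length there is no room for Dyck factors. -/
lemma ascentCount_length_le {q : List E} (v : V) : G.ascentCount v q q.length ≤ 1 := by
  have key : ∀ {q : List E} {v : V} {w : List (Letter E)}, G.IsAscent v q w →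
      w.length = q.length → w = q.map .neg := by
    intro q
    induction q with
    | nil => rintro v w rfl -; rfl
    | cons f q ih =>
      rintro v w ⟨hf, A, B, hA, hB, rfl⟩ hlen
      obtain ⟨n, hn⟩ := hB.exists_length
      simp only [List.length_append, List.length_cons] at hlen
      obtain rfl : A = [] := List.length_eq_zero_iff.1 (by omega)
      rw [ih hB (by simp at hlen; omega)]
      rfl
  refine (Set.ncard_le_ncard (t := {q.map .neg}) ?_ (Set.finite_singleton _)).trans
    (Set.ncard_singleton _).le
  rintro w ⟨hw, hlen⟩
  exact key hw hlen

lemma ascentCount_replicate_succ [Finite E] {e : E} (hsrc : G.src e = r) (htgt : G.tgt e = r)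
    (m n : ℕ) :
    G.ascentCount r (List.replicate (m + 1) e) (m + 1 + 2 * n) =
      ∑ p ∈ Finset.HasAntidiagonal.antidiagonal n,
        G.dyckCount r p.1 * G.ascentCount r (List.replicate m e) (m + 2 * p.2) := by
  have := ascentCount_cons (G := G) e (List.replicate m e) n
  rwa [List.length_replicate, hsrc, htgt] at this

lemma ascentCount_replicate_zero [Finite E] {e : E} (hsrc : G.src e = r) (htgt : G.tgt e = r)
    (m : ℕ) : G.ascentCount r (List.replicate m e) m = 1 := by
  induction m with
  | zero => simp [ascentCount_nil]
  | succ m ih =>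
    have := ascentCount_replicate_succ hsrc htgt m 0
    simpa [dyckCount_zero, ih] using this

lemma ascentCount_replicate_one [Finite E] {e : E} (hsrc : G.src e = r) (htgt : G.tgt e = r)
    (m : ℕ) : G.ascentCount r (List.replicate m e) (m + 2) = m * G.dyckCount r 1 := by
  induction m with
  | zero => simp [ascentCount_nil]
  | succ m ih =>
    have := ascentCount_replicate_succ hsrc htgt m 1
    simp only [Finset.Nat.antidiagonal_succ, Finset.Nat.antidiagonal_zero] at this
    simp [dyckCount_zero, ih, ascentCount_replicate_zero hsrc htgt] at this
    rw [this]
    ring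

/-- A surplus of four is one Dyck word of length four in one of `m` slots, or two of length two in
distinct slots. Doubling avoids the division in the binomial coefficient, and the truncated `m - 1`
is harmless at `m = 0`. -/
lemma ascentCount_replicate_two [Finite E] {e : E} (hsrc : G.src e = r) (htgt : G.tgt e = r)
    (m : ℕ) : 2 * G.ascentCount r (List.replicate m e) (m + 4) =
      2 * m * G.dyckCount r 2 + m * (m - 1) * G.dyckCount r 1 ^ 2 := by
  induction m with
  | zero => simp [ascentCount_nil]
  | succ m ih =>
    have := ascentCount_replicate_succ hsrc htgt m 2
    simp only [Finset.Nat.antidiagonal_succ, Finset.Nat.antidiagonal_zero] at this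
    simp [dyckCount_zero, ascentCount_replicate_zero hsrc htgt,
      ascentCount_replicate_one hsrc htgt] at this
    rw [this, mul_add, ih]
    rcases m with _ | m
    · simp
    · simp only [Nat.add_sub_cancel]; ring

lemma ascentCount_replicate_three [Finite E] {e : E} (hsrc : G.src e = r) (htgt : G.tgt e = r) :
    G.ascentCount r (List.replicate 3 e) 9 = 3 * G.dyckCount r 3 +
      6 * G.dyckCount r 1 * G.dyckCount r 2 + G.dyckCount r 1 ^ 3 := by
  have h1 := ascentCount_replicate_succ hsrc htgt 0 3
  have h2 := ascentCount_replicate_succ hsrc htgt 1 3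
  have h3 := ascentCount_replicate_succ hsrc htgt 2 3
  have t1 := ascentCount_replicate_two hsrc htgt 1
  have t2 := ascentCount_replicate_two hsrc htgt 2
  have o1 := ascentCount_replicate_one hsrc htgt 1
  have o2 := ascentCount_replicate_one hsrc htgt 2
  have z1 := ascentCount_replicate_zero hsrc htgt 1
  have z2 := ascentCount_replicate_zero hsrc htgt 2
  simp only [Finset.Nat.antidiagonal_succ, Finset.Nat.antidiagonal_zero] at h1 h2 h3
  simp [dyckCount_zero, ascentCount_nil] at h1 h2 h3 t1 t2 o1 o2 z1 z2
  have t2' : G.ascentCount r [e, e] 6 = 2 * G.dyckCount r 2 + G.dyckCount r 1 ^ 2 := by linarith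
  simp only [List.replicate]
  rw [h3, h2, h1, t2', t1, o1, o2, z1, z2]
  ring

/-- An upper bound for the number of orbits of length nine, if the edge `e` is a loop at the
root. -/
lemma IsTreeWithRoot.orbitCount_nine_le_of_loop [Finite E] (hr : G.IsTreeWithRoot r)
    {e : {e : E // e ∉ G.treeEdges}} (he : G.src e.1 = r) :
    G.orbitCount e 9 ≤ G.dyckCount r 4 + (3 * G.dyckCount r 3 +
      6 * G.dyckCount r 1 * G.dyckCount r 2 + G.dyckCount r 1 ^ 3) +
      (5 * G.dyckCount r 2 + 10 * G.dyckCount r 1 ^ 2) + 7 * G.dyckCount r 1 + 1 := by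
  have hT : G.IsPath G.treeEdges r (G.src e.1) [] := he.symm
  have htgt := hr.tgt_eq e.2
  have hle := hr.orbitCount_le hT 9
  have hrep : ∀ m, (List.replicate m ([] ++ [e.1])).flatten = List.replicate m e.1 := by
    intro m
    induction m with
    | zero => rfl
    | succ m ih => rw [List.replicate_succ, List.flatten_cons, ih]; rfl
  simp only [hrep] at hle
  have heven : ∀ m, m % 2 = 0 → G.ascentCount r (List.replicate m e.1) 9 = 0 := fun m hm =>
    ascentCount_eq_zero fun n => by rw [List.length_replicate]; omega
  rw [show Finset.Icc 1 9 = {1, 2, 3, 4, 5, 6, 7, 8, 9} by decide] at hle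
  have h1 := ascentCount_singleton (G := G) e.1 4
  have h5 := ascentCount_replicate_two he htgt 5
  have h7 := ascentCount_replicate_one he htgt 7
  have h9 := ascentCount_replicate_zero he htgt 9
  rw [he] at h1
  norm_num at h5 h7 h1
  simp only [Finset.mem_insert, Finset.mem_singleton, Nat.reduceEqDiff, or_self, not_false_eq_true,
    Finset.sum_insert, Finset.sum_singleton, heven, ascentCount_replicate_three he htgt, h9] at hle
  simp only [List.replicate] at hle h5 h7
  rw [h1, h7] at hle
  linarith

/-! ### Orbit numbers of edges that start at a leaf -/

variable {f₁ f₂ : E} {e : {e : E // e ∉ G.treeEdges}}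

lemma ascentCount_triple [Finite E] {f₁ f₂ e : E} (h₁ : G.src f₁ = r) (h₂ : G.src f₂ = G.tgt f₁)
    (h₃ : G.src e = G.tgt f₂) (n : ℕ) :
    G.ascentCount r [f₁, f₂, e] (3 + 2 * n) =
      ∑ p ∈ Finset.HasAntidiagonal.antidiagonal n, G.dyckCount r p.1 *
        ∑ q ∈ Finset.HasAntidiagonal.antidiagonal p.2,
          G.dyckCount (G.tgt f₁) q.1 * G.dyckCount (G.tgt f₂) q.2 := by
  have h := ascentCount_cons (G := G) f₁ [f₂, e] n
  rw [h₁] at h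
  refine h.trans (Finset.sum_congr rfl fun p _ => ?_)
  congr 1
  have h' := ascentCount_cons (G := G) f₂ [e] p.2
  rw [h₂] at h'
  refine h'.trans (Finset.sum_congr rfl fun q _ => ?_)
  rw [← h₃, ← ascentCount_singleton]
  rfl

/-- The closed path has length three, so `3m + 2n = 5` leaves only `m = 1` with one Dyck word of
length two, inserted at one of the three vertices. The upper and lower bounds then coincide. -/
lemma IsTreeWithRoot.orbitCount_five_eq [Finite E] (hr : G.IsTreeWithRoot r)
    (hf₁ : f₁ ∈ G.treeEdges) (hf₂ : f₂ ∈ G.treeEdges) (h₁ : G.src f₁ = r)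
    (h₂ : G.src f₂ = G.tgt f₁) (h₃ : G.src e.1 = G.tgt f₂) :
    G.orbitCount e 5 = G.outDegree r + G.outDegree (G.tgt f₁) + G.outDegree (G.tgt f₂) := by
  have hT : G.IsPath G.treeEdges r (G.src e.1) [f₁, f₂] := ⟨hf₁, h₁, hf₂, h₂, h₃.symm⟩
  have hle := hr.orbitCount_le hT 5
  have hge := hr.ascentCount_le_orbitCount hT 5
  have hz : ∀ m, m ≠ 1 →
      G.ascentCount r (List.replicate m ([f₁, f₂] ++ [e.1])).flatten 5 = 0 := fun m hm =>
    ascentCount_eq_zero fun n => by simp; omega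
  rw [Finset.sum_eq_single 1 (fun m _ hm => hz m hm) (by simp)] at hle
  have hA := ascentCount_triple h₁ h₂ h₃ 1
  simp only [Finset.Nat.antidiagonal_succ, Finset.Nat.antidiagonal_zero] at hA
  simp [dyckCount_zero, dyckCount_one, Finset.Nat.antidiagonal_succ] at hA
  simp at hle hge
  omega

/-- Since `3m + 2n = 9` allows only `m = 1` and `m = 3`, and the latter leaves no room for Dyck
words, the error is at most one. -/
lemma IsTreeWithRoot.orbitCount_nine_bounds [Finite E] (hr : G.IsTreeWithRoot r)
    (hf₁ : f₁ ∈ G.treeEdges) (hf₂ : f₂ ∈ G.treeEdges) (h₁ : G.src f₁ = r)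
    (h₂ : G.src f₂ = G.tgt f₁) (h₃ : G.src e.1 = G.tgt f₂) :
    G.ascentCount r [f₁, f₂, e.1] 9 ≤ G.orbitCount e 9 ∧
      G.orbitCount e 9 ≤ G.ascentCount r [f₁, f₂, e.1] 9 + 1 := by
  have hT : G.IsPath G.treeEdges r (G.src e.1) [f₁, f₂] := ⟨hf₁, h₁, hf₂, h₂, h₃.symm⟩
  refine ⟨hr.ascentCount_le_orbitCount hT 9, (hr.orbitCount_le hT 9).trans ?_⟩
  have hz : ∀ m, m ≠ 1 → m ≠ 3 →
      G.ascentCount r (List.replicate m ([f₁, f₂] ++ [e.1])).flatten 9 = 0 := fun m hm hm' =>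
    ascentCount_eq_zero fun n => by simp; omega
  have h3 := ascentCount_length_le (G := G) (q := (List.replicate 3 ([f₁, f₂] ++ [e.1])).flatten) r
  -- Reordered so that the two terms that can be nonzero are split off first.
  rw [show Finset.Icc 1 9 = {1, 3, 2, 4, 5, 6, 7, 8, 9} by decide, Finset.sum_insert (by decide),
    Finset.sum_insert (by decide), Finset.sum_eq_zero (s := {2, 4, 5, 6, 7, 8, 9})]
  · simp at h3 ⊢
    exact h3
  · intro m hm
    apply hz <;> rintro rfl <;> simp at hm

/-- The number of one-fold ascents of length nine along a path of length three. All edges out of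
the leaf lead to the root, and all children of the middle vertex look alike. -/
lemma ascentCount_triple_nine [Finite E] {f₁ f₂ e : E} (h₁ : G.src f₁ = r)
    (h₂ : G.src f₂ = G.tgt f₁) (h₃ : G.src e = G.tgt f₂)
    (hleaf : ∀ f, G.src f = G.tgt f₂ → G.tgt f = r)
    (hmid : ∀ f, G.src f = G.tgt f₁ → ∀ i, G.dyckCount (G.tgt f) i = G.dyckCount (G.tgt f₂) i)
    {a r₂ d q s : ℕ} (ha : G.dyckCount r 1 = a) (hr₂ : G.dyckCount r 2 = r₂)
    (hd : G.outDegree (G.tgt f₁) = d) (hq : G.outDegree (G.tgt f₂) = q) (hs : d + q = s) :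
    G.dyckCount (G.tgt f₁) 2 = d * s ∧ G.dyckCount (G.tgt f₁) 3 = d * (s ^ 2 + q * a) ∧
    G.ascentCount r [f₁, f₂, e] 9 = s ^ 3 + 2 * s * q * a + q * r₂ + a * s ^ 2 + q * a ^ 2 +
      r₂ * s + G.dyckCount r 3 := by
  have hw := dyckCount_succ_of_forall_eq (G := G) (v := G.tgt f₂) (X := G.dyckCount r)
    fun f hf i => by rw [hleaf f hf]
  have hu := dyckCount_succ_of_forall_eq hmid
  have hw2 := hw 1
  have hw3 := hw 2
  have hu2 := hu 1
  have hu3 := hu 2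
  have hA := ascentCount_triple h₁ h₂ h₃ 3
  simp only [Finset.Nat.antidiagonal_succ, Finset.Nat.antidiagonal_zero] at hw2 hw3 hu2 hu3 hA
  simp [dyckCount_zero, dyckCount_one, hd, hq] at hw2 hw3 hu2 hu3 ha
  simp [dyckCount_zero, dyckCount_one, hd, hq, Finset.Nat.antidiagonal_succ] at hA
  rw [ha] at hw2 hw3
  rw [hr₂, hw2] at hw3
  rw [hw2] at hu3
  rw [hu2] at hu3
  subst hs
  refine ⟨hu2, by rw [hu3]; ring, ?_⟩
  rw [hA, hu3, hu2, hw3, hw2, ha, hr₂]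
  ring

/-- The growth estimate that excludes loops at the root. -/
lemma loop_count_lt {n l p q a s r₂ r₃ r₄ : ℕ} (hn : 0 < n) (hl : 0 < l) (hp : 0 < p)
    (ha : a = n + l) (hs : p + q = s) (hr₂ : r₂ = a ^ 2 + l * a + n * p) (hle : r₂ ≤ s)
    (hr₃ : r₃ = a * r₂ + (l * a + n * p) * a + (l * r₂ + n * (p * s)))
    (hr₄ : r₄ = a * r₃ + (l * a + n * p) * r₂ + (l * r₂ + n * (p * s)) * a +
      (l * r₃ + n * (p * (s ^ 2 + q * a)))) :
    r₄ + (3 * r₃ + 6 * a * r₂ + a ^ 3) + (5 * r₂ + 10 * a ^ 2) + 7 * a + 1 <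
      s ^ 3 + 2 * s * q * a + q * r₂ + a * s ^ 2 + q * a ^ 2 + r₂ * s + r₃ := by
  obtain ⟨n, rfl⟩ := Nat.exists_eq_succ_of_ne_zero hn.ne'
  obtain ⟨l, rfl⟩ := Nat.exists_eq_succ_of_ne_zero hl.ne'
  obtain ⟨p, rfl⟩ := Nat.exists_eq_succ_of_ne_zero hp.ne'
  obtain ⟨k, rfl⟩ := Nat.exists_eq_add_of_le hle
  simp only [Nat.succ_eq_add_one] at *
  -- Writing `s = r₂ + k` and eliminating `q = s - p`, with `n`, `l`, `p` already replaced by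
  -- successors, turns the difference of the two sides into a polynomial that `positivity` accepts.
  obtain rfl : q = a ^ 2 + (l + 1) * a + n * (p + 1) + k := by nlinarith
  subst hr₄ hr₃ hr₂ ha
  zify
  rw [← sub_pos]
  ring_nf
  positivity

/-! ### The shape of a tree of height two -/

lemma IsTreeWithRoot.atLevel_unique (hr : G.IsTreeWithRoot r) {v : V} {m n : ℕ}
    (hm : G.AtLevel r v m) (hn : G.AtLevel r v n) : m = n := by
  obtain ⟨p, hp, rfl⟩ := hm
  obtain ⟨q, hq, rfl⟩ := hn
  rw [(hr v).unique hp hq]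

lemma AtLevel.succ {v : V} {n : ℕ} (h : G.AtLevel r v n) {f : E} (hf : f ∈ G.treeEdges)
    (hv : G.src f = v) : G.AtLevel r (G.tgt f) (n + 1) := by
  obtain ⟨p, hp, rfl⟩ := h
  subst hv
  exact ⟨p ++ [f], hp.concat hf, by simp⟩

/-- A vertex of maximal level exists by finiteness and must be a leaf, since a child would lie one
level deeper. -/
lemma IsTreeWithRoot.level_le [Finite V] (hr : G.IsTreeWithRoot r) {h : ℕ}
    (hleaf : ∀ v, G.IsLeaf v → G.AtLevel r v h) {v : V} {n : ℕ} (hv : G.AtLevel r v n) :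
    n ≤ h := by
  have hr' := hr
  choose p hp _ using hr'
  have : Nonempty V := ⟨r⟩
  obtain ⟨u, hu⟩ := Finite.exists_max fun v => (p v).length
  have hlu : G.AtLevel r u (p u).length := ⟨p u, hp u, rfl⟩
  have hul : G.IsLeaf u := by
    intro f hf hfu
    have h1 := hr.atLevel_unique (hlu.succ hf hfu) ⟨p _, hp _, rfl⟩
    have h2 := hu (G.tgt f)
    omega
  have h1 := hr.atLevel_unique hlu (hleaf u hul)
  have h2 := hr.atLevel_unique hv ⟨p v, hp v, rfl⟩
  have h3 := hu v
  omega

lemma atLevel_zero_iff {v : V} : G.AtLevel r v 0 ↔ r = v := by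
  constructor
  · rintro ⟨p, hp, h⟩
    obtain rfl := List.length_eq_zero_iff.1 h
    exact hp
  · rintro rfl
    exact ⟨[], rfl, rfl⟩

lemma atLevel_one_iff {v : V} :
    G.AtLevel r v 1 ↔ ∃ f ∈ G.treeEdges, G.src f = r ∧ G.tgt f = v := by
  constructor
  · rintro ⟨p, hp, h⟩
    obtain ⟨f, rfl⟩ := List.length_eq_one_iff.1 h
    exact ⟨f, hp⟩
  · rintro ⟨f, h1, h2, h3⟩
    exact ⟨[f], ⟨h1, h2, h3⟩, rfl⟩

lemma atLevel_two_iff {v : V} :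
    G.AtLevel r v 2 ↔ ∃ f₁ ∈ G.treeEdges, ∃ f₂ ∈ G.treeEdges,
      G.src f₁ = r ∧ G.src f₂ = G.tgt f₁ ∧ G.tgt f₂ = v := by
  constructor
  · rintro ⟨p, hp, h⟩
    obtain ⟨f₁, f₂, rfl⟩ := List.length_eq_two.1 h
    exact ⟨f₁, hp.1, f₂, hp.2.2.1, hp.2.1, hp.2.2.2.1, hp.2.2.2.2⟩
  · rintro ⟨f₁, h1, f₂, h2, h3, h4, h5⟩
    exact ⟨[f₁, f₂], ⟨h1, h3, h2, h4, h5⟩, rfl⟩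

lemma outDegree_pos [Finite E] {v : V} {e : E} (he : G.src e = v) : 0 < G.outDegree v :=
  (Set.ncard_pos (Set.toFinite _)).2 ⟨e, he⟩

/-- The first values of the counting function of the Dyck words at the root, if the edges of the
tree that leave the root lead to vertices that look alike. -/
lemma IsTreeWithRoot.dyckCount_root_succ [Finite E] (hr : G.IsTreeWithRoot r) {U : ℕ → ℕ} {N : ℕ}
    (hU : ∀ f ∈ G.treeEdges, G.src f = r → ∀ i ≤ N, G.dyckCount (G.tgt f) i = U i) :
    ∀ n ≤ N, G.dyckCount r (n + 1) =
      G.treeOutDegree r * ∑ p ∈ Finset.HasAntidiagonal.antidiagonal n,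
        U p.1 * G.dyckCount r p.2 +
      {e | e ∉ G.treeEdges ∧ G.src e = r}.ncard * ∑ p ∈ Finset.HasAntidiagonal.antidiagonal n,
        G.dyckCount r p.1 * G.dyckCount r p.2 := by
  classical
  have := Fintype.ofFinite E
  intro n hn
  rw [dyckCount_succ, ← Finset.sum_filter_add_sum_filter_not _ (· ∈ G.treeEdges)]
  congr 1
  · rw [Finset.sum_congr rfl (g := fun _ => ∑ p ∈ Finset.HasAntidiagonal.antidiagonal n,
      U p.1 * G.dyckCount r p.2), Finset.sum_const, smul_eq_mul]
    · congr 1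
      rw [treeOutDegree, ← Set.ncard_coe_finset]
      congr 1
      ext f
      simp [and_comm]
    · intro f hf
      simp only [Finset.mem_filter, Finset.mem_univ, true_and] at hf
      refine Finset.sum_congr rfl fun p hp => ?_
      rw [Finset.HasAntidiagonal.mem_antidiagonal] at hp
      rw [hU f hf.2 hf.1 p.1 (by omega)]
  · rw [Finset.sum_congr rfl (g := fun _ => ∑ p ∈ Finset.HasAntidiagonal.antidiagonal n,
      G.dyckCount r p.1 * G.dyckCount r p.2), Finset.sum_const, smul_eq_mul]
    · congr 1
      rw [← Set.ncard_coe_finset]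
      congr 1
      ext f
      simp [and_comm]
    · intro f hf
      simp only [Finset.mem_filter, Finset.mem_univ, true_and] at hf
      simp only [hr.tgt_eq hf.2]

end DirectedMultigraph

/-! ### The theorem for height two -/

open DirectedMultigraph in
theorem theorem5p6 {V E : Type*} [Finite V] [Finite E] (G : DirectedMultigraph V E)
    (hG : G.StronglyConnected) (htree : G.HasTreeOfUniformHeight 2)
    (h5 : ∀ e e' : {e : E // e ∉ G.treeEdges}, G.orbitCount e 5 = G.orbitCount e' 5)
    (h9 : ∀ e e' : {e : E // e ∉ G.treeEdges}, G.orbitCount e 9 = G.orbitCount e' 9)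
    (h10 : ∀ e e' : {e : E // e ∉ G.treeEdges}, G.orbitCount e 10 = G.orbitCount e' 10) :
    G.IsSphericallyHomogeneous := by
  obtain ⟨r, hr, hleaf⟩ := htree
  have hlvl : ∀ v, G.AtLevel r v 0 ∨ G.AtLevel r v 1 ∨ G.AtLevel r v 2 := by
    intro v
    obtain ⟨p, hp, -⟩ := hr v
    have hv : G.AtLevel r v p.length := ⟨p, hp, rfl⟩
    have h2 := hr.level_le hleaf hv
    interval_cases p.length <;> simp [hv]
  have hleaf2 : ∀ v, G.AtLevel r v 2 → G.IsLeaf v := fun v hv f hf hfv => by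
    have := hr.level_le hleaf (hv.succ hf hfv)
    omega
  have hnleaf : ∀ v n, G.AtLevel r v n → n ≠ 2 → ∃ f ∈ G.treeEdges, G.src f = v := by
    intro v n hv hn
    by_contra! h
    exact hn (hr.atLevel_unique hv (hleaf v h))
  -- A leaf is not the root, so strong connectivity gives it an outgoing edge, necessarily outside
  -- the tree.
  have hout : ∀ v, G.IsLeaf v → ∃ e : {e // e ∉ G.treeEdges}, G.src e.1 = v := by
    intro v hv
    obtain ⟨p, hp⟩ := hG v r
    rcases p with _ | ⟨e, p⟩
    · obtain rfl : v = r := hp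
      have := hr.atLevel_unique (hleaf v hv) (atLevel_zero_iff.2 rfl)
      omega
    · exact ⟨⟨e, fun he => hv e he hp.2.1⟩, hp.2.1⟩
  have hback : ∀ v, G.IsLeaf v → ∀ f, G.src f = v → G.tgt f = r := fun v hv f hf =>
    hr.tgt_eq fun hft => hv f hft hf
  obtain ⟨g₁, hg₁, hg₁r⟩ := hnleaf r 0 (atLevel_zero_iff.2 rfl) (by norm_num)
  have hchild : ∀ f ∈ G.treeEdges, G.src f = r →
      ∃ f' ∈ G.treeEdges, G.src f' = G.tgt f := fun f hf hfr =>
    hnleaf _ 1 (atLevel_one_iff.2 ⟨f, hf, hfr, rfl⟩) (by norm_num)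
  obtain ⟨g₂, hg₂, hg₂s⟩ := hchild g₁ hg₁ hg₁r
  have hl2 : ∀ f₁ ∈ G.treeEdges, ∀ f₂ ∈ G.treeEdges, G.src f₁ = r → G.src f₂ = G.tgt f₁ →
      G.IsLeaf (G.tgt f₂) := fun f₁ hf₁ f₂ hf₂ h₁ h₂ =>
    hleaf2 _ (atLevel_two_iff.2 ⟨f₁, hf₁, f₂, hf₂, h₁, h₂, rfl⟩)
  obtain ⟨e₀, he₀⟩ := hout _ (hl2 g₁ hg₁ g₂ hg₂ hg₁r hg₂s)
  have h5₀ := hr.orbitCount_five_eq hg₁ hg₂ hg₁r hg₂s he₀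
  -- No edge outside of the tree starts at level one.
  have hmid : ∀ f ∈ G.treeEdges, G.src f = r → ∀ e, G.src e = G.tgt f → e ∈ G.treeEdges := by
    intro f hf hfr e he
    by_contra het
    have hT : G.IsPath G.treeEdges r (G.src e) [f] := ⟨hf, hfr, he.symm⟩
    have hle := hr.orbitCount_le (e := ⟨e, het⟩) hT 5
    -- The closed path `f e` has length two, so its ascents have even length, whereas `e₀` has
    -- orbits of length five.
    rw [Finset.sum_eq_zero fun m _ => ascentCount_eq_zero fun n => by simp; omega,
      h5 _ e₀, h5₀] at hle
    have := outDegree_pos hg₁r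
    omega
  set a := G.outDegree r with ha
  set p := G.outDegree (G.tgt g₁) with hp
  set q := G.outDegree (G.tgt g₂) with hq
  set s := p + q with hs
  have ha0 : 0 < a := outDegree_pos hg₁r
  have hp0 : 0 < p := outDegree_pos hg₂s
  have hsum : ∀ f₁ ∈ G.treeEdges, ∀ f₂ ∈ G.treeEdges, G.src f₁ = r → G.src f₂ = G.tgt f₁ →
      G.outDegree (G.tgt f₁) + G.outDegree (G.tgt f₂) = s := by
    intro f₁ hf₁ f₂ hf₂ h₁ h₂
    obtain ⟨e, he⟩ := hout _ (hl2 f₁ hf₁ f₂ hf₂ h₁ h₂)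
    have := hr.orbitCount_five_eq hf₁ hf₂ h₁ h₂ he
    rw [h5 e e₀, h5₀] at this
    omega
  have hsib : ∀ f₁ ∈ G.treeEdges, ∀ f₂ ∈ G.treeEdges, G.src f₁ = r → G.src f₂ = G.tgt f₁ →
      ∀ f, G.src f = G.tgt f₁ → ∀ i, G.dyckCount (G.tgt f) i = G.dyckCount (G.tgt f₂) i := by
    intro f₁ hf₁ f₂ hf₂ h₁ h₂ f hf
    have hft := hmid f₁ hf₁ h₁ f hf
    have h3 := hsum f₁ hf₁ f₂ hf₂ h₁ h₂
    have h4 := hsum f₁ hf₁ f hft h₁ hf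
    refine dyckCount_eq_of_outDegree_eq (X := G.dyckCount r)
      (fun g hg i => by rw [hback _ (hl2 f₁ hf₁ f hft h₁ hf) g hg])
      (fun g hg i => by rw [hback _ (hl2 f₁ hf₁ f₂ hf₂ h₁ h₂) g hg]) (by omega)
  have ha1 : G.dyckCount r 1 = a := dyckCount_one r
  set r₂ := G.dyckCount r 2 with hr₂
  set r₃ := G.dyckCount r 3 with hr₃
  obtain ⟨-, -, hA₀⟩ := ascentCount_triple_nine hg₁r hg₂s he₀
    (hback _ (hl2 g₁ hg₁ g₂ hg₂ hg₁r hg₂s)) (hsib g₁ hg₁ g₂ hg₂ hg₁r hg₂s) ha1 hr₂.symm hp.symm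
    hq.symm hs.symm
  have hB₀ := hr.orbitCount_nine_bounds hg₁ hg₂ hg₁r hg₂s he₀
  -- All leaves have the same out-degree.
  have hdeg : ∀ f₁ ∈ G.treeEdges, ∀ f₂ ∈ G.treeEdges, G.src f₁ = r → G.src f₂ = G.tgt f₁ →
      G.outDegree (G.tgt f₂) = q := by
    intro f₁ hf₁ f₂ hf₂ h₁ h₂
    obtain ⟨e, he⟩ := hout _ (hl2 f₁ hf₁ f₂ hf₂ h₁ h₂)
    obtain ⟨-, -, hA⟩ := ascentCount_triple_nine h₁ h₂ he (hback _ (hl2 f₁ hf₁ f₂ hf₂ h₁ h₂))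
      (hsib f₁ hf₁ f₂ hf₂ h₁ h₂) ha1 hr₂.symm rfl rfl (hsum f₁ hf₁ f₂ hf₂ h₁ h₂)
    have hB := hr.orbitCount_nine_bounds hf₁ hf₂ h₁ h₂ he
    rw [h9 e e₀, hA] at hB
    rw [hA₀] at hB₀
    set d := G.outDegree (G.tgt f₂)
    -- With `s` fixed, the length-nine formula changes by at least `2 * s * a ≥ 2` when the leaf
    -- degree changes by one, more than the tolerance of one in the bounds.
    have hsa : 0 < s * a := Nat.mul_pos (by omega) ha0
    by_contra hne
    rcases Nat.lt_or_gt_of_ne hne with hlt | hlt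
    · have h1 : (d + 1) * (s * a) ≤ q * (s * a) := Nat.mul_le_mul_right _ hlt
      have h2 : d * r₂ ≤ q * r₂ := Nat.mul_le_mul_right _ hlt.le
      have h3 : d * a ^ 2 ≤ q * a ^ 2 := Nat.mul_le_mul_right _ hlt.le
      linarith [hB.2, hB₀.1]
    · have h1 : (q + 1) * (s * a) ≤ d * (s * a) := Nat.mul_le_mul_right _ hlt
      have h2 : q * r₂ ≤ d * r₂ := Nat.mul_le_mul_right _ hlt.le
      have h3 : q * a ^ 2 ≤ d * a ^ 2 := Nat.mul_le_mul_right _ hlt.le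
      linarith [hB.1, hB₀.2]
  have hdeg₁ : ∀ f ∈ G.treeEdges, G.src f = r → G.outDegree (G.tgt f) = p := by
    intro f hf hfr
    obtain ⟨f', hf', hs'⟩ := hchild f hf hfr
    have h1 := hsum f hf f' hf' hfr hs'
    have h2 := hdeg f hf f' hf' hfr hs'
    omega
  -- There are no loops at the root.
  have hloop : ∀ e ∉ G.treeEdges, G.src e ≠ r := by
    intro e he her
    -- All level-one vertices now share their Dyck counts up to index three, which is what the
    -- recursion at the root needs to reach index four.
    have hU : ∀ f ∈ G.treeEdges, G.src f = r → ∀ i ≤ 3,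
        G.dyckCount (G.tgt f) i = if i = 0 then 1 else if i = 1 then p else if i = 2 then p * s
          else p * (s ^ 2 + q * a) := by
      intro f hf hfr i hi
      obtain ⟨f', hf', hs'⟩ := hchild f hf hfr
      obtain ⟨e', he'⟩ := hout _ (hl2 f hf f' hf' hfr hs')
      obtain ⟨h2, h3, -⟩ := ascentCount_triple_nine hfr hs' he' (hback _ (hl2 f hf f' hf' hfr hs'))
        (hsib f hf f' hf' hfr hs') ha1 hr₂.symm (hdeg₁ f hf hfr) (hdeg f hf f' hf' hfr hs') hs.symm
      interval_cases i
      · simp [dyckCount_zero]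
      · simp [dyckCount_one, hdeg₁ f hf hfr]
      · simp [h2]
      · simp [h3]
    have hrec := hr.dyckCount_root_succ hU
    set n := G.treeOutDegree r
    set l := {e | e ∉ G.treeEdges ∧ G.src e = r}.ncard
    have hn : 0 < n := (Set.ncard_pos (Set.toFinite _)).2 ⟨g₁, hg₁, hg₁r⟩
    have hl : 0 < l := (Set.ncard_pos (Set.toFinite _)).2 ⟨e, he, her⟩
    have e1 := hrec 0 (by norm_num)
    have e2 := hrec 1 (by norm_num)
    have e3 := hrec 2 (by norm_num)
    have e4 := hrec 3 (by norm_num)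
    simp only [Finset.Nat.antidiagonal_succ, Finset.Nat.antidiagonal_zero] at e1 e2 e3 e4
    simp [dyckCount_zero, ha1, ← hr₂, ← hr₃] at e1 e2 e3 e4
    have hA := ascentCount_singleton (G := G) e 2
    rw [her] at hA
    have hge := hr.ascentCount_add_outDegree_le_orbitCount (e := ⟨e, he⟩) her
    have h9e := hr.orbitCount_nine_le_of_loop (e := ⟨e, he⟩) her
    norm_num at hA
    -- This reads `r₂ + a ≤ a + p + q`, so `r₂ ≤ s`, the hypothesis of the growth estimate.
    rw [h5 _ e₀, h5₀, hA, ← hr₂] at hge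
    rw [h9 _ e₀, ha1, ← hr₂, ← hr₃] at h9e
    have hlt := loop_count_lt (r₃ := r₃) (r₄ := G.dyckCount r 4) hn hl hp0 e1 hs.symm
      (r₂ := r₂) (by rw [e2, e1]; ring) (by omega) (by rw [e3, e1]; ring) (by rw [e4, e1]; ring)
    rw [← hA₀] at hlt
    have := hB₀.1
    omega
  have hdegleaf : ∀ v, G.IsLeaf v → G.outDegree v = q := by
    intro v hv
    obtain ⟨f₁, hf₁, f₂, hf₂, h₁, h₂, rfl⟩ := atLevel_two_iff.1 (hleaf v hv)
    exact hdeg f₁ hf₁ f₂ hf₂ h₁ h₂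
  refine ⟨r, hr, ⟨2, hleaf⟩, ?_, ?_, fun u v hu hv => (hdegleaf u hu).trans (hdegleaf v hv).symm⟩
  · intro u v n hu hv
    have hn := hr.level_le hleaf hu
    interval_cases n
    · rw [← atLevel_zero_iff.1 hu, ← atLevel_zero_iff.1 hv]
    · have key : ∀ w, G.AtLevel r w 1 → G.treeOutDegree w = p := by
        intro w hw
        obtain ⟨f, hf, hfr, rfl⟩ := atLevel_one_iff.1 hw
        rw [← hdeg₁ f hf hfr, treeOutDegree, outDegree]
        congr 1
        ext e
        exact ⟨fun h => h.2, fun h => ⟨hmid f hf hfr e h, h⟩⟩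
      rw [key u hu, key v hv]
    · have key : ∀ w, G.AtLevel r w 2 → G.treeOutDegree w = 0 := by
        intro w hw
        rw [treeOutDegree, Set.ncard_eq_zero (Set.toFinite _)]
        exact Set.eq_empty_iff_forall_notMem.2 fun e he => hleaf2 w hw e he.1 he.2
      rw [key u hu, key v hv]
  · intro e he
    rcases hlvl (G.src e) with h | h | h
    · exact absurd (atLevel_zero_iff.1 h).symm (hloop e he)
    · obtain ⟨f, hf, hfr, hfe⟩ := atLevel_one_iff.1 h
      exact absurd (hmid f hf hfr e hfe.symm) he
    · exact hleaf2 _ h
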